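/- \textbf{Setting.} A labelled net system has places $P$, transitions $T$, presets ${}^\bullet t$ and postsets $t^\bullet$, an initial marking and a labelling. A transition $t$ is enabled at $m:P\to\mathbb N$ if $m(p)\ge 1$ for every $p\in{}^\bullet t$ and, in a net with read arcs, for every activator $p$ of $t$; its occurrence removes a token from each $p\in{}^\bullet t\setminus t^\bullet$ and adds one to each $p\in t^\bullet\setminus{}^\bullet t$. For a sequence $w$ of transitions, $m[w\rangle m'$ means that $w$ can fire from $m$ and leads to $m'$. Let $\Sigma_1,\dots,\Sigma_n$ be 1-safe labelled nets (agents) with pairwise disjoint sets $P_i$ of places and $T_i$ of transitions and labelling functions $\ell_i:T_i\to\Lambda$. Their \emph{synchronization on transitions} is the net $\Sigma$ with places $\bigcup_i P_i$ and initial marking $m_0=\bigcup_i\iota_i$, where $\iota_i$ is the initial marking of $\Sigma_i$; its transitions are the pairs $(a,ST)$ where $a\in\bigcup_i\ell_i(T_i)$ and $ST$ assigns to each agent $i$ with $a\in\ell_i(T_i)$ a transition $ST(i)\in\ell_i^{-1}(a)$, and $ST(i)=\varepsilon$ to the others (which do not participate). The preset (postset) of $(a,ST)$ is the union of the presets (postsets)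 of its components, and its label is $\ell(a,ST)=a$. A label is \emph{shared} if it occurs in at least two agents. For $(a,ST)$ with $a$ shared, let $i_1<\dots<i_k$ be the participating agents. The \emph{simulating net} $\Sigma'$ is obtained as follows. Agent $i$ is replaced by a net with read arcs that has (1) the places $P_i$, initially marked as in $\Sigma_i$, and a synchronization place $p_i^{sync}$, initially marked; (2) for each $(a,ST)$ with $a$ shared and $ST(i)=t\ne\varepsilon$, complementary places $t_{in}$ (initially marked) and $t_{out}$ (initially empty) and transitions $t_b,t_e$, all indexed by $(a,ST)$, with ${}^\bullet t_b={}^\bullet t\cup\{p_i^{sync},t_{in}\}$, $t_b^\bullet=\{t_{out}\}$, ${}^\bullet t_e=\{t_{out}\}$, $t_e^\bullet=t^\bullet\cup\{p_i^{sync},t_{in}\}$, and label $a$; (3) for each such $(a,ST)$ and each other participant $j$, local copies of the two places belonging to $ST(j)$ (an external binary variable) and two transitions with empty label, moving the token between these copies in either direction; (4) the transitions of $T_i$ whose label is not shared, with their arcs and labels; these either all have an additional self-loop at $p_i^{sync}$, for all agents, or have none, for all agents (the theorem is claimed for both variants). Read arcs: for $i=i_1$, $t_b$ reads the in-place and $t_e$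 the out-place of $ST(i_k)$; for $i=i_r$ with $r>1$, $t_b$ reads the out-place and $t_e$ the in-place of $ST(i_{r-1})$. The nets so obtained are composed by fusion of sequential components: each copy of a variable is identified with the original, and each transition $t_b$ or $t_e$ is fused with all the transitions that change the local copies of its variable in the same way. For a marking $M$ of $\Sigma$, let $sp(M)$ be the marking of $\Sigma'$ that agrees with $M$ on $\bigcup_iP_i$, is $1$ on all places $p_i^{sync}$ and $t_{in}$, and $0$ on all places $t_{out}$. Let $\kappa(a,ST)=t$ if $a$ is not shared and $t$ is the only component of $ST$, and otherwise $$\kappa(a,ST)=ST(i_1)_b\,ST(i_2)_b\cdots ST(i_k)_b\,ST(i_1)_e\,ST(i_2)_e\cdots ST(i_k)_e .$$ Let $\pi(t)=\ell_i(t)$ if $t\in T_i$ has a label that is not shared, $\pi(ST(i_1)_e)=a$ for each $(a,ST)$ with $a$ shared, and let $\pi$ be empty on all other transitions. Extend $\kappa$, $\pi$ and $\ell$ to sequences by concatenation, omitting empty labels. $Parikh(w)$ is the multiset of the elements of the sequence $w$. \textbf{Theorem.} Let $M_1,M_2\in[m_0\rangle$ be reachable markings of $\Sigma$. (i) For every sequence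 $v$ of transitions of $\Sigma'$ with $sp(M_1)[v\rangle sp(M_2)$ there is a sequence $u$ of transitions of $\Sigma$ with $M_1[u\rangle M_2$, $Parikh(v)=Parikh(\kappa(u))$ and $\pi(v)=\ell(u)$. (ii) For every sequence $u$ of transitions of $\Sigma$ with $M_1[u\rangle M_2$ there is a sequence $v$ of transitions of $\Sigma'$ with $sp(M_1)[v\rangle sp(M_2)$, $Parikh(v)=Parikh(\kappa(u))$ and $\pi(v)=\ell(u)$. -/

import Mathlib

noncomputable section

open scoped Classical

namespace PetriMAS

/-! ### Labelled nets, nets with read arcs, firing -/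

/-- A marking: the number of tokens on every place. -/
abbrev Marking (P : Type*) := P → ℕ

/-- A labelled net system. The flow relation is given by the presets and the postsets of the
transitions. -/
structure PetriNet (P T L : Type*) where
  pre : T → Set P
  post : T → Set P
  init : Marking P
  label : T → L

/-- A labelled net system with read arcs; `read t` is the set of activators of `t`. -/
structure ReadNet (P T L : Type*) extends PetriNet P T L where
  read : T → Set P

/-- `Run step m w m'`: the sequence `w` of transitions leads from `m` to `m'`. -/
inductive Run {S T : Type*} (step : S → T → S → Prop) : S → List T → S → Prop
  | nil (m : S) : Run step m [] m
  | cons {m m₁ m₂ : S} {t : T} {w : List T} :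
      step m t m₁ → Run step m₁ w m₂ → Run step m (t :: w) m₂

namespace PetriNet

variable {P T L : Type*} (N : PetriNet P T L)

/-- Every place of the preset carries a token. -/
def Enabled (m : Marking P) (t : T) : Prop := ∀ p ∈ N.pre t, 1 ≤ m p

/-- The marking produced by the occurrence of `t` in `m`. -/
def effect (m : Marking P) (t : T) : Marking P := fun p =>
  if p ∈ N.pre t \ N.post t then m p - 1
  else if p ∈ N.post t \ N.pre t then m p + 1
  else m p

/-- `m[t⟩m'` -/
def Step (m : Marking P) (t : T) (m' : Marking P) : Prop :=
  N.Enabled m t ∧ m' = N.effect m t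

/-- `m[w⟩m'` for a sequence `w` of transitions. -/
def Fires (m : Marking P) (w : List T) (m' : Marking P) : Prop := Run N.Step m w m'

/-- `m ∈ [m₀⟩` -/
def Reachable (m : Marking P) : Prop := ∃ w : List T, N.Fires N.init w m

/-- The net system is 1-safe. -/
def IsSafe : Prop := ∀ m, N.Reachable m → ∀ p, m p ≤ 1

end PetriNet

namespace ReadNet

variable {P T L : Type*} (N : ReadNet P T L)

/-- Every place of the preset and every activator carries a token. -/
def Enabled (m : Marking P) (t : T) : Prop := ∀ p ∈ N.pre t ∪ N.read t, 1 ≤ m p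

/-- `m[t⟩m'`; read arcs do not change the effect of a transition. -/
def Step (m : Marking P) (t : T) (m' : Marking P) : Prop :=
  N.Enabled m t ∧ m' = N.effect m t

/-- `m[w⟩m'` for a sequence `w` of transitions. -/
def Fires (m : Marking P) (w : List T) (m' : Marking P) : Prop := Run N.Step m w m'

end ReadNet

/-- The Parikh vector of a sequence, as a multiset. -/
def parikh {X : Type*} (w : List X) : Multiset X := (w : Multiset X)

/-! ### Fusion of sequential components

A family of nets is composed over a set `X` of variables with values in `D`. The places of the
`i`-th net are its own places `K i`, together with a copy `(x, d)` of every value `d` of every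
variable `x` that is external for `i`. The component of the variable `x` in the net that controls
it consists of the places `internal x d`, and the copies `(x, d)` are identified with them. -/

section Fusion

variable {ι : Type*} {K : ι → Type*} {X D : Type*}

/-- Which places represent the variables, and which variables are external for which net. -/
structure Interface {ι : Type*} (K : ι → Type*) (X D : Type*) where
  internal : X → D → Σ i, K i
  imports : ι → Set X

/-- The places of the `i`-th net before the fusion. -/
abbrev Interface.Place (I : Interface K X D) (i : ι) := K i ⊕ (I.imports i × D)

/-- The place of the fused net with which a place of the `i`-th net is identified. -/
def Interface.glue (I : Interface K X D) (i : ι) : I.Place i → Σ i, K i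
  | Sum.inl k => ⟨i, k⟩
  | Sum.inr (x, d) => I.internal x d

variable {T : ι → Type*} {Λ : Type*} (I : Interface K X D)
  (N : ∀ i, ReadNet (I.Place i) (T i) (Set Λ))

/-- `s` moves the token in the component of `x` from the value `d` to the value `d'`. -/
def Moves (s : Σ i, T i) (x : X) (d d' : D) : Prop :=
  Set.range (I.internal x) ∩ {p | ∃ k, Sum.inl k ∈ (N s.1).pre s.2 ∧ p = ⟨s.1, k⟩}
      = {I.internal x d} ∧
  Set.range (I.internal x) ∩ {p | ∃ k, Sum.inl k ∈ (N s.1).post s.2 ∧ p = ⟨s.1, k⟩}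
      = {I.internal x d'}

/-- The transitions of the `j`-th net that are fused with `s`: those which change the local copy
of a variable in the way `s` changes the variable itself. -/
def partners (s : Σ i, T i) (j : ι) : Set (T j) :=
  {t' | ∃ (x : I.imports j) (d d' : D), Moves I N s x d d' ∧
    Sum.inr (x, d) ∈ (N j).pre t' ∧ Sum.inr (x, d') ∈ (N j).post t'}

/-- `s` gives rise to a transition of the fused net: it does not itself circulate the token of an
external variable, and every net that imports a variable changed by `s` can follow. -/
def Fusable (s : Σ i, T i) : Prop :=
  (∀ e, Sum.inr e ∉ (N s.1).pre s.2 ∧ Sum.inr e ∉ (N s.1).post s.2) ∧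
  ∀ x d d', Moves I N s x d d' → ∀ j, x ∈ I.imports j → (partners I N s j).Nonempty

/-- The transitions of the fused net. The transition given by `s` stands for the group consisting
of `s` and of all its partners. -/
abbrev FusedTransition := {s : Σ i, T i // Fusable I N s}

/-- The group of transitions of the `j`-th net that take part in the fused transition `s`. -/
def group (s : Σ i, T i) (j : ι) : Set (T j) :=
  {t' | s = ⟨j, t'⟩} ∪ partners I N s j

/-- Fusion of the nets `N i` along the components of the variables. -/
def fusion : ReadNet (Σ i, K i) (FusedTransition I N) (Set Λ) where
  pre s := {p | ∃ j, ∃ t' ∈ group I N s.1 j, ∃ q ∈ (N j).pre t', I.glue j q = p}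
  post s := {p | ∃ j, ∃ t' ∈ group I N s.1 j, ∃ q ∈ (N j).post t', I.glue j q = p}
  read s := {p | ∃ j, ∃ t' ∈ group I N s.1 j, ∃ q ∈ (N j).read t', I.glue j q = p}
  init p := (N p.1).init (Sum.inl p.2)
  label s := {a | ∃ j, ∃ t' ∈ group I N s.1 j, a ∈ (N j).label t'}

end Fusion

/-! ### Composition of agents by synchronization on common labels -/

section Agents

variable {n : ℕ} {Λ : Type*} {P T : Fin n → Type*} (Ag : ∀ i, PetriNet (P i) (T i) Λ)

/-- A combination of transitions with a common label `lab`: one from every agent that uses the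
label, none (`ε`) from the others. -/
@[ext]
structure SyncTrans where
  lab : Λ
  comp : ∀ i, Option (T i)
  used : ∃ i, (comp i).isSome
  label_eq : ∀ i t, comp i = some t → (Ag i).label t = lab
  absent : ∀ i, comp i = none → ∀ t, (Ag i).label t ≠ lab

/-- The global net, synchronized on transitions. -/
def syncNet : PetriNet (Σ i, P i) (SyncTrans Ag) Λ where
  pre s := {p | ∃ t, s.comp p.1 = some t ∧ p.2 ∈ (Ag p.1).pre t}
  post s := {p | ∃ t, s.comp p.1 = some t ∧ p.2 ∈ (Ag p.1).post t}
  init p := (Ag p.1).init p.2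
  label s := s.lab

/-- The label of the transition `t` of the agent `i` occurs in another agent, too. -/
def Shared (i : Fin n) (t : T i) : Prop := ∃ j, j ≠ i ∧ ∃ t', (Ag j).label t' = (Ag i).label t

variable {Ag}

/-- The agents that take part in `s`. -/
def SyncTrans.agents (s : SyncTrans Ag) : Finset (Fin n) :=
  Finset.univ.filter fun i => (s.comp i).isSome

theorem SyncTrans.agents_nonempty (s : SyncTrans Ag) : s.agents.Nonempty := by
  obtain ⟨i, hi⟩ := s.used
  exact ⟨i, by simp [SyncTrans.agents, hi]⟩

/-- The smallest agent that takes part in `s`. -/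
def SyncTrans.first (s : SyncTrans Ag) : Fin n := s.agents.min' s.agents_nonempty

/-- The largest participating agent smaller than `i`; if there is none, the largest participating
agent. -/
def SyncTrans.prev (s : SyncTrans Ag) (i : Fin n) : Fin n :=
  if h : (s.agents.filter (· < i)).Nonempty then (s.agents.filter (· < i)).max' h
  else s.agents.max' s.agents_nonempty

variable (Ag)

/-! ### The agents prepared for the synchronization on data -/

/-- The copy of the shared transition `tr` of the agent `i` made for the combination `st`. It names
a binary variable controlled by the agent `i`. -/
structure Copy (i : Fin n) where
  st : SyncTrans Ag
  tr : T i
  mem : st.comp i = some tr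
  shared : Shared Ag i tr

/-- The values of a binary variable: initially it is `inn`. -/
inductive Val
  | inn
  | out

/-- The two parts, begin and end, into which a transition is split. -/
inductive Half
  | b
  | e

/-- The value of the variable before a half transition. -/
def Half.source : Half → Val
  | b => Val.inn
  | e => Val.out

/-- The value of the variable after a half transition. -/
def Half.target : Half → Val
  | b => Val.out
  | e => Val.inn

/-- The own places of the prepared agent `i`: the old ones, the synchronization place, and a pair
of complementary places for every copy of a shared transition of `i`. -/
inductive OwnPlace (i : Fin n)
  | orig (p : P i)
  | sync
  | var (x : Copy Ag i) (d : Val)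

/-- The variables and the agents for which they are external: an agent that takes part in a
combination has access to the variables which the other participants have for this combination. -/
def interface : Interface (OwnPlace Ag) (Σ i, Copy Ag i) Val where
  internal x d := ⟨x.1, OwnPlace.var x.2 d⟩
  imports j := {x | x.1 ≠ j ∧ (x.2.st.comp j).isSome}

/-- The transitions of the prepared agent `i`: the old ones whose label is not shared, the halves
of the copies of the shared ones, and the changes of the external variables. -/
inductive ModTrans (i : Fin n)
  | uniq (t : T i) (h : ¬ Shared Ag i t)
  | own (x : Copy Ag i) (k : Half)
  | ext (x : (interface Ag).imports i) (k : Half)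

/-- Where a half of the copy `x` tests the variable of the previous participant: the first agent
begins when the last one is in `inn` and ends when the last one is in `out`; any other agent begins
when the previous one is in `out` and ends when the previous one is in `inn`. -/
def testedValue {i : Fin n} (x : Copy Ag i) (k : Half) : Val :=
  if i = x.st.first then k.source else k.target

/-- The prepared agent `i`. If `lock` holds, transitions with a label that is not shared are
connected to the synchronization place by a self-loop, and so cannot occur while the agent takes
part in a synchronization; otherwise they are not connected to it. -/
def module (lock : Prop) (i : Fin n) :
    ReadNet ((interface Ag).Place i) (ModTrans Ag i) (Set Λ) where
  pre
    | .uniq t _ => {q | (∃ p ∈ (Ag i).pre t, q = Sum.inl (.orig p)) ∨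
        (lock ∧ q = Sum.inl .sync)}
    | .own x .b => {q | (∃ p ∈ (Ag i).pre x.tr, q = Sum.inl (.orig p)) ∨
        q = Sum.inl .sync ∨ q = Sum.inl (.var x .inn)}
    | .own x .e => {Sum.inl (.var x .out)}
    | .ext x k => {Sum.inr (x, k.source)}
  post
    | .uniq t _ => {q | (∃ p ∈ (Ag i).post t, q = Sum.inl (.orig p)) ∨
        (lock ∧ q = Sum.inl .sync)}
    | .own x .b => {Sum.inl (.var x .out)}
    | .own x .e => {q | (∃ p ∈ (Ag i).post x.tr, q = Sum.inl (.orig p)) ∨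
        q = Sum.inl .sync ∨ q = Sum.inl (.var x .inn)}
    | .ext x k => {Sum.inr (x, k.target)}
  read
    | .uniq _ _ => ∅
    | .own x k => {q | ∃ y : (interface Ag).imports i, y.1.2.st = x.st ∧ y.1.1 = x.st.prev i ∧
        q = Sum.inr (y, testedValue Ag x k)}
    | .ext _ _ => ∅
  init
    | Sum.inl (.orig p) => (Ag i).init p
    | Sum.inl .sync => 1
    | Sum.inl (.var _ .inn) => 1
    | Sum.inl (.var _ .out) => 0
    | Sum.inr (_, .inn) => 1
    | Sum.inr (_, .out) => 0
  label
    | .uniq t _ => {(Ag i).label t}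
    | .own x _ => {(Ag i).label x.tr}
    | .ext _ _ => ∅

/-- The transitions of the simulating net. -/
abbrev SimTrans (lock : Prop) := FusedTransition (interface Ag) (module Ag lock)

/-- The simulating net: the data driven composition of the prepared agents. -/
def simNet (lock : Prop) : ReadNet (Σ i, OwnPlace Ag i) (SimTrans Ag lock) (Set Λ) :=
  fusion (interface Ag) (module Ag lock)

theorem fusable_uniq (lock : Prop) (i : Fin n) (t : T i) (h : ¬ Shared Ag i t) :
    Fusable (interface Ag) (module Ag lock) ⟨i, ModTrans.uniq t h⟩ := by
  refine ⟨fun e => by simp [module], ?_⟩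
  rintro x d d' ⟨h1, -⟩
  have hx : (interface Ag).internal x d ∈ ({(interface Ag).internal x d} : Set _) := rfl
  rw [← h1] at hx
  obtain ⟨-, k, hk, he⟩ := hx
  obtain ⟨i', x⟩ := x
  simp only [interface, Sigma.mk.injEq] at he
  obtain ⟨rfl, he⟩ := he
  have he := eq_of_heq he
  subst he
  simp [module] at hk

theorem fusable_own (lock : Prop) (i : Fin n) (x : Copy Ag i) (k : Half) :
    Fusable (interface Ag) (module Ag lock) ⟨i, ModTrans.own x k⟩ := by
  refine ⟨fun e => by cases k <;> simp [module], ?_⟩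
  rintro y d d' hm j hj
  refine ⟨ModTrans.ext ⟨y, hj⟩ k, ⟨y, hj⟩, d, d', hm, ?_⟩
  obtain ⟨h1, h2⟩ := hm
  have hx : (interface Ag).internal y d ∈ ({(interface Ag).internal y d} : Set _) := rfl
  rw [← h1] at hx
  obtain ⟨-, q, hq, he⟩ := hx
  have hx' : (interface Ag).internal y d' ∈ ({(interface Ag).internal y d'} : Set _) := rfl
  rw [← h2] at hx'
  obtain ⟨-, q', hq', he'⟩ := hx'
  obtain ⟨i', y⟩ := y
  simp only [interface, Sigma.mk.injEq] at he he'
  obtain ⟨rfl, he⟩ := he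
  have he := eq_of_heq he
  have he' := eq_of_heq he'.2
  subst he he'
  cases k <;> simp_all [module, Half.source, Half.target]

/-- A transition of the agent `i` whose label is not shared, in the simulating net. -/
def uniqT (lock : Prop) (i : Fin n) (t : T i) (h : ¬ Shared Ag i t) : SimTrans Ag lock :=
  ⟨⟨i, ModTrans.uniq t h⟩, fusable_uniq Ag lock i t h⟩

/-- A half of a copy of a shared transition of the agent `i`, in the simulating net. -/
def halfT (lock : Prop) (i : Fin n) (x : Copy Ag i) (k : Half) : SimTrans Ag lock :=
  ⟨⟨i, ModTrans.own x k⟩, fusable_own Ag lock i x k⟩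

/-! ### Comparison of the two nets -/

/-- The marking of the simulating net that corresponds to a marking of the global net. -/
def sp (M : Marking (Σ i, P i)) : Marking (Σ i, OwnPlace Ag i)
  | ⟨i, .orig p⟩ => M ⟨i, p⟩
  | ⟨_, .sync⟩ => 1
  | ⟨_, .var _ .inn⟩ => 1
  | ⟨_, .var _ .out⟩ => 0

/-- The sequence simulating one transition: `t` itself, if the label is not shared (then there is
exactly one participant); otherwise the participants begin one after the other, in the order of the
agents, and then end one after the other, in the same order. -/
def kappa (lock : Prop) (s : SyncTrans Ag) : List (SimTrans Ag lock) :=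
  ((List.finRange n).flatMap fun i =>
    match h : s.comp i with
    | none => []
    | some t => if hs : Shared Ag i t then [halfT Ag lock i ⟨s, t, h, hs⟩ .b]
        else [uniqT Ag lock i t hs]) ++
  ((List.finRange n).flatMap fun i =>
    match h : s.comp i with
    | none => []
    | some t => if hs : Shared Ag i t then [halfT Ag lock i ⟨s, t, h, hs⟩ .e] else [])

/-- The visible label of a transition of the simulating net; `none` is the empty label. -/
def visible (lock : Prop) (s : SimTrans Ag lock) : Option Λ :=
  match s.1 with
  | ⟨i, .uniq t _⟩ => some ((Ag i).label t)
  | ⟨i, .own x .e⟩ => if i = x.st.first then some ((Ag i).label x.tr) else none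
  | ⟨_, .own _ .b⟩ => none
  | ⟨_, .ext _ _⟩ => none

end Agents

end PetriMAS

end

open PetriMAS

/-! For (ii), `kappa` applied to `u` fires as it stands: along its two sweeps over the agents every
handshake test is satisfied, and an unshared transition is simulated by itself.

For (i), all markings met from `sp M₁` have the form `between m act`: the synchronization place lets
an agent be inside at most one combination, and `act` records which. The tests form a cycle through
the participants. The first one may begin only while the last is out of the combination, and each
later one only after its predecessor has begun; so the active participants grow as a prefix. The
first one may end only while the last is active, hence when all are, and each later one only after
its predecessor has ended; so afterwards they shrink as a suffix. No second round of the same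
combination can start before the last participant has left.

Hence a combination may be taken to occur in one instant, the moment its first participant ends,
which is also the half that `visible` labels. The global marking `M` is recovered from `m` by giving
back the tokens consumed for combinations not yet committed and by adding in advance those still
owed for committed ones. `Represents` is this invariant. It is preserved without a global step by
`begin_step` and `end_step`, and with one global step by `commit_step` and `step_single`. Induction
on `v` in `exists_fires_of_fires` then produces `u`, while counts of the halves, corrected by the
combinations in progress, give the Parikh equality. -/

noncomputable section

open scoped Classical

namespace PetriMAS

section Agents

variable {n : ℕ} {Λ : Type*} {P T : Fin n → Type*} {Ag : ∀ i, PetriNet (P i) (T i) Λ}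

/-! ### Participants of a combination -/

namespace SyncTrans

variable (s : SyncTrans Ag)

theorem mem_agents {i : Fin n} : i ∈ s.agents ↔ ∃ t, s.comp i = some t := by
  simp [agents, Option.isSome_iff_exists]

theorem comp_eq_none {s : SyncTrans Ag} {j : Fin n} (hj : j ∉ s.agents) : s.comp j = none := by
  by_contra h
  exact hj (s.mem_agents.2 (Option.ne_none_iff_exists'.1 h))

theorem first_mem : s.first ∈ s.agents := Finset.min'_mem _ _

theorem first_le {i : Fin n} (hi : i ∈ s.agents) : s.first ≤ i := Finset.min'_le _ _ hi

theorem prev_mem (i : Fin n) : s.prev i ∈ s.agents := by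
  unfold prev
  split
  · next h => exact (Finset.mem_filter.1 (Finset.max'_mem _ h)).1
  · exact Finset.max'_mem _ _

/-- No participant lies below the first one, so `prev` falls back to the maximum. This closes the
cycle of tests. -/
theorem le_prev_first {j : Fin n} (hj : j ∈ s.agents) : j ≤ s.prev s.first := by
  unfold prev
  split
  · next h =>
    obtain ⟨k, hk⟩ := h
    rw [Finset.mem_filter] at hk
    exact absurd hk.2 (not_lt.2 (s.first_le hk.1))
  · exact Finset.le_max' _ _ hj

theorem prev_lt {i : Fin n} (hi : i ∈ s.agents) (h : i ≠ s.first) : s.prev i < i := by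
  have hne : (s.agents.filter (· < i)).Nonempty :=
    ⟨s.first, Finset.mem_filter.2 ⟨s.first_mem, lt_of_le_of_ne (s.first_le hi) h.symm⟩⟩
  unfold prev
  rw [dif_pos hne]
  exact (Finset.mem_filter.1 (Finset.max'_mem _ hne)).2

theorem le_prev {i j : Fin n} (hj : j ∈ s.agents) (h : j < i) : j ≤ s.prev i := by
  have hm : j ∈ s.agents.filter (· < i) := Finset.mem_filter.2 ⟨hj, h⟩
  unfold prev
  rw [dif_pos ⟨j, hm⟩]
  exact Finset.le_max' _ _ hm

theorem label_eq_of_mem {i j : Fin n} {t : T i} {t' : T j} (h : s.comp i = some t)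
    (h' : s.comp j = some t') : (Ag i).label t = (Ag j).label t' :=
  (s.label_eq i t h).trans (s.label_eq j t' h').symm

theorem eq_of_not_shared {i j : Fin n} {t : T i} (h : s.comp i = some t) (hs : ¬ Shared Ag i t)
    (hj : j ∈ s.agents) : j = i := by
  by_contra hne
  obtain ⟨t', ht'⟩ := s.mem_agents.1 hj
  exact hs ⟨j, hne, t', s.label_eq_of_mem ht' h⟩

theorem comp_eq_none_of_not_shared {i j : Fin n} {t : T i} (h : s.comp i = some t)
    (hs : ¬ Shared Ag i t) (hj : j ≠ i) : s.comp j = none := by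
  by_contra hne
  exact hj (s.eq_of_not_shared h hs (s.mem_agents.2 (Option.ne_none_iff_exists'.1 hne)))

end SyncTrans

namespace Copy

variable {i : Fin n}

theorem eq_of_st {x y : Copy Ag i} (h : x.st = y.st) : x = y := by
  obtain ⟨s, t, hm, hs⟩ := x
  obtain ⟨s', t', hm', hs'⟩ := y
  obtain rfl : s = s' := h
  obtain rfl : t = t' := Option.some.inj (hm.symm.trans hm')
  rfl

theorem mem_agents (x : Copy Ag i) : i ∈ x.st.agents := x.st.mem_agents.2 ⟨_, x.mem⟩

theorem exists_ne (x : Copy Ag i) : ∃ j ∈ x.st.agents, j ≠ i := by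
  obtain ⟨j, hj, t', ht'⟩ := x.shared
  refine ⟨j, x.st.mem_agents.2 (Option.ne_none_iff_exists'.1 fun h => ?_), hj⟩
  exact x.st.absent j h t' (ht'.trans (x.st.label_eq i _ x.mem))

/-- A participant with an unshared label would be the only one, whereas a copy guarantees at least
two. -/
theorem exists_of_mem (x : Copy Ag i) {j : Fin n} (hj : j ∈ x.st.agents) :
    ∃ y : Copy Ag j, y.st = x.st := by
  obtain ⟨t, ht⟩ := x.st.mem_agents.1 hj
  refine ⟨⟨x.st, t, ht, ?_⟩, rfl⟩
  by_contra hs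
  obtain ⟨k, hk, hki⟩ := x.exists_ne
  exact hki ((x.st.eq_of_not_shared ht hs hk).trans (x.st.eq_of_not_shared ht hs x.mem_agents).symm)

/-- For the first participant this needs a second one, so that the maximum differs from the minimum.
It makes the tested variable external, as the read arcs require. -/
theorem prev_ne (x : Copy Ag i) : x.st.prev i ≠ i := by
  by_cases h : i = x.st.first
  · intro he
    obtain ⟨j, hj, hji⟩ := x.exists_ne
    have h1 := x.st.le_prev_first hj
    rw [← h, he] at h1
    exact hji (le_antisymm h1 (h ▸ x.st.first_le hj))
  · exact (x.st.prev_lt x.mem_agents h).ne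

end Copy

/-! ### The arcs of the simulating net -/

variable {lock : Prop} {i : Fin n}

/-- The preset of an unshared transition contains no variable place, so no variable is moved. -/
theorem partners_uniq (t : T i) (h : ¬ Shared Ag i t) (j : Fin n) :
    partners (interface Ag) (module Ag lock) ⟨i, .uniq t h⟩ j = ∅ := by
  ext t'
  simp only [partners, Set.mem_ofPred_eq, Set.mem_empty_iff_false, iff_false]
  rintro ⟨x, d, d', ⟨h1, -⟩, -⟩
  have hx : (interface Ag).internal x.1 d ∈ ({(interface Ag).internal x.1 d} : Set _) := rfl
  rw [← h1] at hx
  obtain ⟨-, k, hk, he⟩ := hx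
  obtain ⟨⟨i', x⟩, hj⟩ := x
  simp only [interface, Sigma.mk.injEq] at he
  obtain ⟨rfl, he⟩ := he
  have he := eq_of_heq he
  subst he
  simp [module] at hk

/-- A half moves only its own variable, so its partners merely move the copies of that variable.
After gluing, their arcs coincide with arcs the half already has, and fusion adds nothing to its
preset, postset or read arcs. -/
theorem eq_ext_of_mem_partners {x : Copy Ag i} {k : Half} {j : Fin n} {t' : ModTrans Ag j}
    (h : t' ∈ partners (interface Ag) (module Ag lock) ⟨i, .own x k⟩ j) :
    ∃ hj : (⟨i, x⟩ : Σ i, Copy Ag i) ∈ (interface Ag).imports j, t' = .ext ⟨⟨i, x⟩, hj⟩ k := by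
  obtain ⟨⟨⟨i', y⟩, hj⟩, d, d', ⟨h1, -⟩, h3, -⟩ := h
  have hx : (interface Ag).internal ⟨i', y⟩ d ∈
      ({(interface Ag).internal ⟨i', y⟩ d} : Set _) := rfl
  rw [← h1] at hx
  obtain ⟨-, q, hq, he⟩ := hx
  simp only [interface, Sigma.mk.injEq] at he
  obtain ⟨rfl, he⟩ := he
  have he := eq_of_heq he
  subst he
  have key : y = x ∧ d = k.source := by
    cases k <;> simp [module] at hq <;> exact hq
  obtain ⟨rfl, rfl⟩ := key
  refine ⟨hj, ?_⟩
  rcases t' with ⟨t, ht⟩ | ⟨z, l⟩ | ⟨z, l⟩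
  · simp [module] at h3
  · cases l <;> simp [module] at h3
  · simp only [module, Set.mem_singleton_iff, Sum.inr.injEq, Prod.mk.injEq] at h3
    obtain ⟨rfl, h4⟩ := h3
    cases k <;> cases l <;> simp_all [Half.source]

theorem pre_uniqT (t : T i) (h : ¬ Shared Ag i t) :
    (simNet Ag lock).pre (uniqT Ag lock i t h) =
      {q | (∃ p ∈ (Ag i).pre t, q = ⟨i, .orig p⟩) ∨ (lock ∧ q = ⟨i, .sync⟩)} := by
  ext q
  simp only [simNet, fusion, uniqT, group, partners_uniq, Set.union_empty, Set.mem_ofPred_eq]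
  constructor
  · rintro ⟨j, t', h1, r, hr, rfl⟩
    cases h1
    rcases hr with ⟨p, hp, rfl⟩ | ⟨hl, rfl⟩
    · exact Or.inl ⟨p, hp, rfl⟩
    · exact Or.inr ⟨hl, rfl⟩
  · rintro (⟨p, hp, rfl⟩ | ⟨hl, rfl⟩)
    · exact ⟨i, _, rfl, _, Or.inl ⟨p, hp, rfl⟩, rfl⟩
    · exact ⟨i, _, rfl, _, Or.inr ⟨hl, rfl⟩, rfl⟩

theorem post_uniqT (t : T i) (h : ¬ Shared Ag i t) :
    (simNet Ag lock).post (uniqT Ag lock i t h) =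
      {q | (∃ p ∈ (Ag i).post t, q = ⟨i, .orig p⟩) ∨ (lock ∧ q = ⟨i, .sync⟩)} := by
  ext q
  simp only [simNet, fusion, uniqT, group, partners_uniq, Set.union_empty, Set.mem_ofPred_eq]
  constructor
  · rintro ⟨j, t', h1, r, hr, rfl⟩
    cases h1
    rcases hr with ⟨p, hp, rfl⟩ | ⟨hl, rfl⟩
    · exact Or.inl ⟨p, hp, rfl⟩
    · exact Or.inr ⟨hl, rfl⟩
  · rintro (⟨p, hp, rfl⟩ | ⟨hl, rfl⟩)
    · exact ⟨i, _, rfl, _, Or.inl ⟨p, hp, rfl⟩, rfl⟩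
    · exact ⟨i, _, rfl, _, Or.inr ⟨hl, rfl⟩, rfl⟩

theorem read_uniqT (t : T i) (h : ¬ Shared Ag i t) :
    (simNet Ag lock).read (uniqT Ag lock i t h) = ∅ := by
  ext q
  simp only [simNet, fusion, uniqT, group, partners_uniq, Set.union_empty, Set.mem_ofPred_eq,
    Set.mem_empty_iff_false, iff_false]
  rintro ⟨j, t', h1, r, hr, rfl⟩
  cases h1
  exact hr

theorem pre_halfT_begin (x : Copy Ag i) :
    (simNet Ag lock).pre (halfT Ag lock i x .b) =
      {q | (∃ p ∈ (Ag i).pre x.tr, q = ⟨i, .orig p⟩) ∨ q = ⟨i, .sync⟩ ∨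
        q = ⟨i, .var x .inn⟩} := by
  ext q
  simp only [simNet, fusion, halfT, group, Set.mem_ofPred_eq]
  constructor
  · rintro ⟨j, t', h1 | h1, r, hr, rfl⟩
    · cases h1
      rcases hr with ⟨p, hp, rfl⟩ | rfl | rfl
      · exact Or.inl ⟨p, hp, rfl⟩
      · exact Or.inr (Or.inl rfl)
      · exact Or.inr (Or.inr rfl)
    · obtain ⟨hj, rfl⟩ := eq_ext_of_mem_partners h1
      cases hr
      exact Or.inr (Or.inr rfl)
  · rintro (⟨p, hp, rfl⟩ | rfl | rfl)
    · exact ⟨i, _, Or.inl rfl, _, Or.inl ⟨p, hp, rfl⟩, rfl⟩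
    · exact ⟨i, _, Or.inl rfl, _, Or.inr (Or.inl rfl), rfl⟩
    · exact ⟨i, _, Or.inl rfl, _, Or.inr (Or.inr rfl), rfl⟩

theorem post_halfT_begin (x : Copy Ag i) :
    (simNet Ag lock).post (halfT Ag lock i x .b) = {⟨i, .var x .out⟩} := by
  ext q
  simp only [simNet, fusion, halfT, group, Set.mem_ofPred_eq]
  constructor
  · rintro ⟨j, t', h1 | h1, r, hr, rfl⟩
    · cases h1
      cases hr
      rfl
    · obtain ⟨hj, rfl⟩ := eq_ext_of_mem_partners h1
      cases hr
      rfl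
  · rintro rfl
    exact ⟨i, _, Or.inl rfl, _, rfl, rfl⟩

theorem pre_halfT_end (x : Copy Ag i) :
    (simNet Ag lock).pre (halfT Ag lock i x .e) = {⟨i, .var x .out⟩} := by
  ext q
  simp only [simNet, fusion, halfT, group, Set.mem_ofPred_eq]
  constructor
  · rintro ⟨j, t', h1 | h1, r, hr, rfl⟩
    · cases h1
      cases hr
      rfl
    · obtain ⟨hj, rfl⟩ := eq_ext_of_mem_partners h1
      cases hr
      rfl
  · rintro rfl
    exact ⟨i, _, Or.inl rfl, _, rfl, rfl⟩

theorem post_halfT_end (x : Copy Ag i) :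
    (simNet Ag lock).post (halfT Ag lock i x .e) =
      {q | (∃ p ∈ (Ag i).post x.tr, q = ⟨i, .orig p⟩) ∨ q = ⟨i, .sync⟩ ∨
        q = ⟨i, .var x .inn⟩} := by
  ext q
  simp only [simNet, fusion, halfT, group, Set.mem_ofPred_eq]
  constructor
  · rintro ⟨j, t', h1 | h1, r, hr, rfl⟩
    · cases h1
      rcases hr with ⟨p, hp, rfl⟩ | rfl | rfl
      · exact Or.inl ⟨p, hp, rfl⟩
      · exact Or.inr (Or.inl rfl)
      · exact Or.inr (Or.inr rfl)
    · obtain ⟨hj, rfl⟩ := eq_ext_of_mem_partners h1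
      cases hr
      exact Or.inr (Or.inr rfl)
  · rintro (⟨p, hp, rfl⟩ | rfl | rfl)
    · exact ⟨i, _, Or.inl rfl, _, Or.inl ⟨p, hp, rfl⟩, rfl⟩
    · exact ⟨i, _, Or.inl rfl, _, Or.inr (Or.inl rfl), rfl⟩
    · exact ⟨i, _, Or.inl rfl, _, Or.inr (Or.inr rfl), rfl⟩

theorem read_halfT (x : Copy Ag i) (k : Half) :
    (simNet Ag lock).read (halfT Ag lock i x k) =
      {q | ∃ y : Copy Ag (x.st.prev i), y.st = x.st ∧
        q = ⟨x.st.prev i, .var y (testedValue Ag x k)⟩} := by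
  ext q
  simp only [simNet, fusion, halfT, group, Set.mem_ofPred_eq]
  constructor
  · rintro ⟨j, t', h1 | h1, r, hr, rfl⟩
    · cases h1
      obtain ⟨⟨⟨i', y⟩, hy⟩, h2, h3, rfl⟩ := hr
      subst h3
      exact ⟨y, h2, rfl⟩
    · obtain ⟨hj, rfl⟩ := eq_ext_of_mem_partners h1
      cases hr
  · rintro ⟨y, hy, rfl⟩
    have hmem : (⟨x.st.prev i, y⟩ : Σ i, Copy Ag i) ∈ (interface Ag).imports i :=
      ⟨x.prev_ne, by simp [hy, x.mem]⟩
    exact ⟨i, _, Or.inl rfl, _, ⟨⟨_, hmem⟩, hy, rfl, rfl⟩, rfl⟩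

theorem eq_uniqT_or_eq_halfT (τ : SimTrans Ag lock) :
    (∃ i t h, τ = uniqT Ag lock i t h) ∨ ∃ i x k, τ = halfT Ag lock i x k := by
  obtain ⟨⟨i, t | ⟨x, k⟩ | ⟨x, k⟩⟩, hτ⟩ := τ
  · exact Or.inl ⟨i, _, _, rfl⟩
  · exact Or.inr ⟨i, x, k, rfl⟩
  -- A change of an external variable circulates a foreign token, so it yields no fused transition
  -- of its own.
  · exact absurd rfl (hτ.1 (x, k.source)).1

/-! ### Intermediate markings of the simulating net -/

/-- The marking of the simulating net with the tokens `m` on the original places, in which the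
agent `i` has begun, and not yet ended, the combination `act i`. -/
def between (m : Marking (Σ i, P i)) (act : Fin n → Option (SyncTrans Ag)) :
    Marking (Σ i, OwnPlace Ag i)
  | ⟨i, .orig p⟩ => m ⟨i, p⟩
  | ⟨i, .sync⟩ => if act i = none then 1 else 0
  | ⟨i, .var x .inn⟩ => if act i = some x.st then 0 else 1
  | ⟨i, .var x .out⟩ => if act i = some x.st then 1 else 0

theorem sp_eq_between (M : Marking (Σ i, P i)) : sp Ag M = between M fun _ => none := by
  funext ⟨i, q⟩
  rcases q with p | _ | ⟨x, _ | _⟩ <;> simp [sp, between]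

theorem mem_pre_syncNet {s : SyncTrans Ag} {t : T i} (h : s.comp i = some t) {p : P i} :
    (⟨i, p⟩ : Σ i, P i) ∈ (syncNet Ag).pre s ↔ p ∈ (Ag i).pre t := by
  simp [syncNet, h]

theorem mem_post_syncNet {s : SyncTrans Ag} {t : T i} (h : s.comp i = some t) {p : P i} :
    (⟨i, p⟩ : Σ i, P i) ∈ (syncNet Ag).post s ↔ p ∈ (Ag i).post t := by
  simp [syncNet, h]

/-- The predecessor's copy for the same combination is unique, and exactly one of its two
complementary places is marked; hence a read arc is a test of `act`. -/
theorem enabled_halfT_reads {x : Copy Ag i} {k : Half} {m : Marking (Σ i, P i)}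
    {act : Fin n → Option (SyncTrans Ag)} :
    (∀ q ∈ (simNet Ag lock).read (halfT Ag lock i x k), 1 ≤ between m act q) ↔
      (act (x.st.prev i) = some x.st ↔ testedValue Ag x k = .out) := by
  obtain ⟨y, hy⟩ := x.exists_of_mem (x.st.prev_mem i)
  rw [read_halfT]
  have : (∀ q ∈ {q | ∃ y : Copy Ag (x.st.prev i), y.st = x.st ∧
        q = (⟨x.st.prev i, .var y (testedValue Ag x k)⟩ : Σ i, OwnPlace Ag i)},
          1 ≤ between m act q) ↔
      1 ≤ between m act ⟨x.st.prev i, .var y (testedValue Ag x k)⟩ := by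
    constructor
    · intro h
      exact h _ ⟨y, hy, rfl⟩
    · rintro h _ ⟨z, hz, rfl⟩
      rwa [Copy.eq_of_st (hz.trans hy.symm)]
  rw [this]
  cases testedValue Ag x k <;> by_cases h : act (x.st.prev i) = some x.st <;>
    simp [between, hy, h]

/-- The sole component of `s` has the arcs of `s` on the original places. The optional self-loop
leaves the marking alone and only demands that the agent be idle. -/
theorem step_uniqT {t : T i} {h : ¬ Shared Ag i t} {s : SyncTrans Ag} (hs : s.comp i = some t)
    {m : Marking (Σ i, P i)} {act : Fin n → Option (SyncTrans Ag)}
    {M' : Marking (Σ i, OwnPlace Ag i)} :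
    (simNet Ag lock).Step (between m act) (uniqT Ag lock i t h) M' ↔
      (syncNet Ag).Enabled m s ∧ (lock → act i = none) ∧
        M' = between ((syncNet Ag).effect m s) act := by
  have heff : (simNet Ag lock).effect (between m act) (uniqT Ag lock i t h) =
      between ((syncNet Ag).effect m s) act := by
    funext ⟨j, q⟩
    simp only [PetriNet.effect, pre_uniqT, post_uniqT]
    by_cases hj : j = i
    · subst hj
      rcases q with p | _ | ⟨x, _ | _⟩ <;>
        simp [between, PetriNet.effect, mem_pre_syncNet hs, mem_post_syncNet hs]
    · have hn := s.comp_eq_none_of_not_shared hs h hj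
      rcases q with p | _ | ⟨x, _ | _⟩ <;> simp [between, PetriNet.effect, hj, syncNet, hn]
  have hen : (simNet Ag lock).Enabled (between m act) (uniqT Ag lock i t h) ↔
      (syncNet Ag).Enabled m s ∧ (lock → act i = none) := by
    simp only [ReadNet.Enabled, pre_uniqT, read_uniqT, Set.union_empty, PetriNet.Enabled]
    constructor
    · intro h1
      refine ⟨?_, fun hl => ?_⟩
      · rintro ⟨j, p⟩ ⟨t', ht', hp⟩
        by_cases hj : j = i
        · subst hj
          obtain rfl : t = t' := Option.some.inj (hs.symm.trans ht')
          exact h1 ⟨j, .orig p⟩ (Or.inl ⟨p, hp, rfl⟩)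
        · simp [s.comp_eq_none_of_not_shared hs h hj] at ht'
      · have h2 := h1 ⟨i, .sync⟩ (Or.inr ⟨hl, rfl⟩)
        by_contra h3
        simp [between, h3] at h2
    · rintro ⟨h1, h2⟩ q (⟨p, hp, rfl⟩ | ⟨hl, rfl⟩)
      · exact h1 ⟨i, p⟩ ((mem_pre_syncNet hs).2 hp)
      · simp [between, h2 hl]
  rw [ReadNet.Step, heff, hen, and_assoc]

/-- The token on the synchronization place is what makes the agent idle, and idleness already
implies the token on the in-place. The postset contains no original place, so the whole preset is
consumed, self-loop places included. -/
theorem step_halfT_begin {x : Copy Ag i} {m : Marking (Σ i, P i)}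
    {act : Fin n → Option (SyncTrans Ag)} {M' : Marking (Σ i, OwnPlace Ag i)} :
    (simNet Ag lock).Step (between m act) (halfT Ag lock i x .b) M' ↔
      (∀ q ∈ (syncNet Ag).pre x.st, q.1 = i → 1 ≤ m q) ∧ act i = none ∧
        (act (x.st.prev i) = some x.st ↔ i ≠ x.st.first) ∧
        M' = between (fun q => if q ∈ (syncNet Ag).pre x.st ∧ q.1 = i then m q - 1 else m q)
          (Function.update act i (some x.st)) := by
  have hen : (simNet Ag lock).Enabled (between m act) (halfT Ag lock i x .b) ↔
      (∀ q ∈ (syncNet Ag).pre x.st, q.1 = i → 1 ≤ m q) ∧ act i = none ∧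
        (act (x.st.prev i) = some x.st ↔ i ≠ x.st.first) := by
    have htest : testedValue Ag x .b = .out ↔ i ≠ x.st.first := by
      unfold testedValue
      split <;> simp_all [Half.source, Half.target]
    rw [← htest, ← enabled_halfT_reads (lock := lock) (m := m)]
    simp only [ReadNet.Enabled, Set.mem_union, or_imp, forall_and, pre_halfT_begin, ← and_assoc]
    refine and_congr_left' ?_
    constructor
    · intro h1
      refine ⟨?_, ?_⟩
      · rintro ⟨j, p⟩ hp rfl
        exact h1 ⟨j, .orig p⟩ (Or.inl ⟨p, (mem_pre_syncNet x.mem).1 hp, rfl⟩)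
      · have h2 := h1 ⟨i, .sync⟩ (Or.inr (Or.inl rfl))
        by_contra h3
        simp [between, h3] at h2
    · rintro ⟨h1, h2⟩ q (⟨p, hp, rfl⟩ | rfl | rfl)
      · exact h1 ⟨i, p⟩ ((mem_pre_syncNet x.mem).2 hp) rfl
      · simp [between, h2]
      · simp [between, h2]
  have heff : act i = none → (simNet Ag lock).effect (between m act) (halfT Ag lock i x .b) =
      between (fun q => if q ∈ (syncNet Ag).pre x.st ∧ q.1 = i then m q - 1 else m q)
        (Function.update act i (some x.st)) := by
    intro ha
    funext ⟨j, q⟩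
    simp only [PetriNet.effect, pre_halfT_begin, post_halfT_begin]
    by_cases hj : j = i
    · subst hj
      rcases q with p | _ | ⟨y, _ | _⟩
      · simp [between, mem_pre_syncNet x.mem]
      · simp [between, ha]
      · by_cases hy : y = x
        · simp [between, ha, hy]
        · simpa [between, ha, hy] using fun h => hy (Copy.eq_of_st h.symm)
      · by_cases hy : y = x
        · simp [between, ha, hy]
        · simpa [between, ha, hy] using fun h => hy (Copy.eq_of_st h.symm)
    · rcases q with p | _ | ⟨x, _ | _⟩ <;> simp [between, hj]
  rw [ReadNet.Step, hen]
  constructor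
  · rintro ⟨⟨h1, h2, h3⟩, h4⟩
    exact ⟨h1, h2, h3, by rw [h4, heff h2]⟩
  · rintro ⟨h1, h2, h3, h4⟩
    exact ⟨⟨h1, h2, h3⟩, by rw [h4, heff h2]⟩

theorem step_halfT_end {x : Copy Ag i} {m : Marking (Σ i, P i)}
    {act : Fin n → Option (SyncTrans Ag)} {M' : Marking (Σ i, OwnPlace Ag i)} :
    (simNet Ag lock).Step (between m act) (halfT Ag lock i x .e) M' ↔
      act i = some x.st ∧ (act (x.st.prev i) = some x.st ↔ i = x.st.first) ∧
        M' = between (fun q => if q ∈ (syncNet Ag).post x.st ∧ q.1 = i then m q + 1 else m q)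
          (Function.update act i none) := by
  have hen : (simNet Ag lock).Enabled (between m act) (halfT Ag lock i x .e) ↔
      act i = some x.st ∧ (act (x.st.prev i) = some x.st ↔ i = x.st.first) := by
    have htest : testedValue Ag x .e = .out ↔ i = x.st.first := by
      unfold testedValue
      split <;> simp_all [Half.source, Half.target]
    rw [← htest, ← enabled_halfT_reads (lock := lock) (m := m)]
    simp only [ReadNet.Enabled, Set.mem_union, or_imp, forall_and, pre_halfT_end]
    refine and_congr_left' ?_
    by_cases h : act i = some x.st <;> simp [between, h]
  have heff : act i = some x.st →
      (simNet Ag lock).effect (between m act) (halfT Ag lock i x .e) =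
      between (fun q => if q ∈ (syncNet Ag).post x.st ∧ q.1 = i then m q + 1 else m q)
        (Function.update act i none) := by
    intro ha
    funext ⟨j, q⟩
    simp only [PetriNet.effect, pre_halfT_end, post_halfT_end]
    by_cases hj : j = i
    · subst hj
      rcases q with p | _ | ⟨y, _ | _⟩
      · simp [between, mem_post_syncNet x.mem]
      · simp [between, ha]
      · by_cases hy : y = x
        · simp [between, ha, hy]
        · simpa [between, ha, hy] using fun h => hy (Copy.eq_of_st h.symm)
      · by_cases hy : y = x
        · simp [between, ha, hy]
        · simpa [between, ha, hy] using fun h => hy (Copy.eq_of_st h.symm)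
    · rcases q with p | _ | ⟨x, _ | _⟩ <;> simp [between, hj]
  rw [ReadNet.Step, hen]
  constructor
  · rintro ⟨⟨h1, h2⟩, h3⟩
    exact ⟨h1, h2, by rw [h3, heff h1]⟩
  · rintro ⟨h1, h2, h3⟩
    exact ⟨⟨h1, h2⟩, by rw [h3, heff h1]⟩

end Agents

/-! ### Concatenation of runs -/

namespace Run

variable {S T : Type*} {step : S → T → S → Prop}

theorem append {m₁ m₂ m₃ : S} {v w : List T} (h : Run step m₁ v m₂) (h' : Run step m₂ w m₃) :
    Run step m₁ (v ++ w) m₃ := by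
  induction h with
  | nil m => exact h'
  | cons hs _ ih => exact .cons hs (ih h')

theorem single {m₁ m₂ : S} {t : T} (h : step m₁ t m₂) : Run step m₁ [t] m₂ := .cons h (.nil _)

/-- Here `σ k` is the state reached once the agents with index below `k` have been treated. -/
theorem flatMap_finRange {n : ℕ} (σ : ℕ → S) (f : Fin n → List T)
    (h : ∀ i : Fin n, Run step (σ i) (f i) (σ (i + 1))) :
    Run step (σ 0) ((List.finRange n).flatMap f) (σ n) := by
  induction n generalizing σ with
  | zero => exact .nil _
  | succ n ih =>
    rw [List.finRange_succ, List.flatMap_cons, List.flatMap_map]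
    refine (h 0).append (ih (fun k => σ (k + 1)) (fun i => f i.succ) fun i => ?_)
    simpa using h i.succ

end Run

section Agents

variable {n : ℕ} {Λ : Type*} {P T : Fin n → Type*} {Ag : ∀ i, PetriNet (P i) (T i) Λ}

/-! ### The simulating sequence of a combination -/

variable (lock : Prop)

/-- The transitions of the agent `i` in the first part of the simulating sequence. -/
def kappaBegin (s : SyncTrans Ag) (i : Fin n) : List (SimTrans Ag lock) :=
  match h : s.comp i with
  | none => []
  | some t => if hs : Shared Ag i t then [halfT Ag lock i ⟨s, t, h, hs⟩ .b]
      else [uniqT Ag lock i t hs]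

/-- The transitions of the agent `i` in the second part of the simulating sequence. -/
def kappaEnd (s : SyncTrans Ag) (i : Fin n) : List (SimTrans Ag lock) :=
  match h : s.comp i with
  | none => []
  | some t => if hs : Shared Ag i t then [halfT Ag lock i ⟨s, t, h, hs⟩ .e] else []

theorem kappa_eq (s : SyncTrans Ag) :
    kappa Ag lock s = (List.finRange n).flatMap (kappaBegin lock s) ++
      (List.finRange n).flatMap (kappaEnd lock s) := rfl

variable {i : Fin n}

theorem kappaBegin_of_none {s : SyncTrans Ag} (h : s.comp i = none) :
    kappaBegin lock s i = [] := by
  unfold kappaBegin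
  split
  · rfl
  · next t h' => simp [h] at h'

theorem kappaEnd_of_none {s : SyncTrans Ag} (h : s.comp i = none) :
    kappaEnd lock s i = [] := by
  unfold kappaEnd
  split
  · rfl
  · next t h' => simp [h] at h'

theorem kappaBegin_of_not_shared {s : SyncTrans Ag} {t : T i} (h : s.comp i = some t)
    (hs : ¬ Shared Ag i t) : kappaBegin lock s i = [uniqT Ag lock i t hs] := by
  unfold kappaBegin
  split
  · next h' => simp [h] at h'
  · next t' h' =>
    obtain rfl : t = t' := Option.some.inj (h.symm.trans h')
    rw [dif_neg hs]

theorem kappaEnd_of_not_shared {s : SyncTrans Ag} {t : T i} (h : s.comp i = some t)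
    (hs : ¬ Shared Ag i t) : kappaEnd lock s i = [] := by
  unfold kappaEnd
  split
  · next h' => simp [h] at h'
  · next t' h' =>
    obtain rfl : t = t' := Option.some.inj (h.symm.trans h')
    rw [dif_neg hs]

theorem kappaBegin_copy (x : Copy Ag i) : kappaBegin lock x.st i = [halfT Ag lock i x .b] := by
  unfold kappaBegin
  split
  · next h => simp [x.mem] at h
  · next t h =>
    obtain ⟨s, t', hm, hs⟩ := x
    obtain rfl : t' = t := Option.some.inj (hm.symm.trans h)
    rw [dif_pos hs]

theorem kappaEnd_copy (x : Copy Ag i) : kappaEnd lock x.st i = [halfT Ag lock i x .e] := by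
  unfold kappaEnd
  split
  · next h => simp [x.mem] at h
  · next t h =>
    obtain ⟨s, t', hm, hs⟩ := x
    obtain rfl : t' = t := Option.some.inj (hm.symm.trans h)
    rw [dif_pos hs]

theorem flatMap_finRange_eq_of_forall_ne {α : Type*} (f : Fin n → List α)
    (h : ∀ j, j ≠ i → f j = []) : (List.finRange n).flatMap f = f i := by
  have key : ∀ l : List (Fin n), l.Nodup → l.flatMap f = if i ∈ l then f i else [] := by
    intro l hl
    induction l with
    | nil => rfl
    | cons a l ih =>
      rw [List.nodup_cons] at hl
      rw [List.flatMap_cons, ih hl.2]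
      by_cases ha : a = i
      · subst ha
        simp [hl.1]
      · simp [h a ha, Ne.symm ha]
  rw [key _ (List.nodup_finRange n), if_pos (List.mem_finRange i)]

theorem kappa_of_not_shared {s : SyncTrans Ag} {t : T i} (h : s.comp i = some t)
    (hs : ¬ Shared Ag i t) : kappa Ag lock s = [uniqT Ag lock i t hs] := by
  have hn : ∀ j, j ≠ i → s.comp j = none := fun j => s.comp_eq_none_of_not_shared h hs
  rw [kappa_eq, flatMap_finRange_eq_of_forall_ne _ fun j hj => kappaBegin_of_none lock (hn j hj),
    flatMap_finRange_eq_of_forall_ne _ fun j hj => kappaEnd_of_none lock (hn j hj),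
    kappaBegin_of_not_shared lock h hs, kappaEnd_of_not_shared lock h hs, List.append_nil]

/-- Either the label of a combination is not shared, or every participant has a copy for it. -/
theorem SyncTrans.not_shared_or_copy (s : SyncTrans Ag) :
    (∃ i t, s.comp i = some t ∧ ¬ Shared Ag i t) ∨ ∃ i, ∃ x : Copy Ag i, x.st = s := by
  obtain ⟨t, ht⟩ := s.mem_agents.1 s.first_mem
  by_cases hs : Shared Ag _ t
  · exact Or.inr ⟨_, ⟨s, t, ht, hs⟩, rfl⟩
  · exact Or.inl ⟨_, t, ht, hs⟩

/-! ### The visible labels -/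

@[simp]
theorem visible_uniqT (t : T i) (hs : ¬ Shared Ag i t) :
    visible Ag lock (uniqT Ag lock i t hs) = some ((Ag i).label t) := rfl

@[simp]
theorem visible_halfT_begin (x : Copy Ag i) : visible Ag lock (halfT Ag lock i x .b) = none := rfl

@[simp]
theorem visible_halfT_end (x : Copy Ag i) : visible Ag lock (halfT Ag lock i x .e) =
    if i = x.st.first then some x.st.lab else none := by
  rw [← x.st.label_eq i _ x.mem]
  rfl

/-- For a shared label the only visible half is the end of the first participant, and it occurs
once. -/
theorem filterMap_visible_kappa (s : SyncTrans Ag) :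
    (kappa Ag lock s).filterMap (visible Ag lock) = [s.lab] := by
  obtain ⟨i, t, ht, hs⟩ | ⟨i, x, rfl⟩ := s.not_shared_or_copy
  · rw [kappa_of_not_shared lock ht hs]
    simp [s.label_eq i t ht]
  · have hend (j : Fin n) : (kappaEnd lock x.st j).filterMap (visible Ag lock) =
        if j = x.st.first then [x.st.lab] else [] := by
      by_cases hj : j ∈ x.st.agents
      · obtain ⟨z, hz⟩ := x.exists_of_mem hj
        rw [← hz, kappaEnd_copy]
        by_cases h : j = z.st.first <;> simp [h]
      · have h1 : x.st.comp j = none := SyncTrans.comp_eq_none hj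
        have h2 : j ≠ x.st.first := fun h => hj (h ▸ x.st.first_mem)
        simp [kappaEnd_of_none lock h1, h2]
    have hbegin (j : Fin n) : (kappaBegin lock x.st j).filterMap (visible Ag lock) = [] := by
      by_cases hj : j ∈ x.st.agents
      · obtain ⟨z, hz⟩ := x.exists_of_mem hj
        rw [← hz, kappaBegin_copy]
        simp
      · have h1 : x.st.comp j = none := SyncTrans.comp_eq_none hj
        simp [kappaBegin_of_none lock h1]
    rw [kappa_eq, List.filterMap_append, List.filterMap_flatMap, List.filterMap_flatMap]
    simp only [hbegin, hend]
    rw [flatMap_finRange_eq_of_forall_ne (i := x.st.first) _ fun j hj => if_neg hj]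
    simp

theorem filterMap_visible_flatMap_kappa (u : List (SyncTrans Ag)) :
    (u.flatMap (kappa Ag lock)).filterMap (visible Ag lock) = u.map (syncNet Ag).label := by
  rw [List.filterMap_flatMap]
  simp only [filterMap_visible_kappa]
  induction u with
  | nil => rfl
  | cons s u ih => simp [ih, syncNet]

/-! ### The simulating sequence can fire -/

theorem SyncTrans.mem_agents_of_mem_pre {s : SyncTrans Ag} {q : Σ i, P i}
    (h : q ∈ (syncNet Ag).pre s) : q.1 ∈ s.agents := by
  obtain ⟨t, ht, -⟩ := h
  exact s.mem_agents.2 ⟨t, ht⟩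

theorem SyncTrans.mem_agents_of_mem_post {s : SyncTrans Ag} {q : Σ i, P i}
    (h : q ∈ (syncNet Ag).post s) : q.1 ∈ s.agents := by
  obtain ⟨t, ht, -⟩ := h
  exact s.mem_agents.2 ⟨t, ht⟩

/-- In the order of the agents the tests hold: the first participant sees the last one still idle,
and every other sees its predecessor already begun. -/
theorem fires_begins (x : Copy Ag i) {m : Marking (Σ i, P i)}
    (hm : (syncNet Ag).Enabled m x.st) :
    (simNet Ag lock).Fires (between m fun _ => none)
      ((List.finRange n).flatMap (kappaBegin lock x.st))
      (between (fun q => if q ∈ (syncNet Ag).pre x.st then m q - 1 else m q)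
        fun j => if j ∈ x.st.agents then some x.st else none) := by
  have key := Run.flatMap_finRange (step := (simNet Ag lock).Step)
    (fun k => between (fun q => if q ∈ (syncNet Ag).pre x.st ∧ q.1.val < k then m q - 1 else m q)
        fun j => if j ∈ x.st.agents ∧ j.val < k then some x.st else none)
    (kappaBegin lock x.st) ?_
  · simpa [ReadNet.Fires] using key
  intro j
  by_cases hj : j ∈ x.st.agents
  · obtain ⟨y, hy⟩ := x.exists_of_mem hj
    rw [← hy] at hj hm ⊢
    rw [kappaBegin_copy]
    refine Run.single (step_halfT_begin.2 ⟨?_, by simp, ?_, ?_⟩)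
    · rintro q hq rfl
      simpa using hm q hq
    · by_cases hf : j = y.st.first
      · have h1 := y.st.le_prev_first hj
        rw [← hf] at h1
        have h2 : ¬ j ≠ y.st.first := fun h => h hf
        simp [h2, not_lt.2 h1]
      · have h1 := y.st.prev_lt hj hf
        simp [hf, h1, y.st.prev_mem]
    · congr 1
      · funext q
        by_cases hq : q ∈ (syncNet Ag).pre y.st
        · rcases lt_trichotomy q.1 j with h | h | h
          · simp [hq, h, h.ne]
            omega
          · simp [hq, h]
          · have : ¬ q.1.val < j.val + 1 := by omega
            simp [hq, h.ne', this, not_lt.2 h.le]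
        · simp [hq]
      · funext k
        rcases lt_trichotomy k j with h | h | h
        · have : k.val < j.val + 1 := by omega
          simp [h.ne, this, h]
        · simp [h, hj]
        · have : ¬ k.val < j.val + 1 := by omega
          simp [h.ne', this, not_lt.2 h.le]
  · have h1 : x.st.comp j = none := SyncTrans.comp_eq_none hj
    rw [kappaBegin_of_none lock h1]
    -- The index `j` is not a participant, so moving the bound from `j` to `j + 1` changes neither
    -- the marking nor `act`.
    have hlt : ∀ k ∈ x.st.agents, (k.val < j.val + 1 ↔ k.val < j.val) := by
      intro k hk
      have : k.val ≠ j.val := fun h => hj (Fin.ext h ▸ hk)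
      omega
    convert Run.nil _ using 2
    · funext q
      have : q ∈ (syncNet Ag).pre x.st ∧ q.1.val < j.val + 1 ↔
          q ∈ (syncNet Ag).pre x.st ∧ q.1.val < j.val :=
        and_congr_right fun h => hlt _ (SyncTrans.mem_agents_of_mem_pre h)
      simp only [this]
    · funext k
      have : k ∈ x.st.agents ∧ k.val < j.val + 1 ↔ k ∈ x.st.agents ∧ k.val < j.val :=
        and_congr_right fun h => hlt _ h
      simp only [this]

/-- The first participant sees the last one still active, since nobody has ended; every other finds
its predecessor already gone. -/
theorem fires_ends (x : Copy Ag i) (m : Marking (Σ i, P i)) :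
    (simNet Ag lock).Fires
      (between m fun j => if j ∈ x.st.agents then some x.st else none)
      ((List.finRange n).flatMap (kappaEnd lock x.st))
      (between (fun q => if q ∈ (syncNet Ag).post x.st then m q + 1 else m q) fun _ => none) := by
  have key := Run.flatMap_finRange (step := (simNet Ag lock).Step)
    (fun k => between (fun q => if q ∈ (syncNet Ag).post x.st ∧ q.1.val < k then m q + 1 else m q)
        fun j => if j ∈ x.st.agents ∧ k ≤ j.val then some x.st else none)
    (kappaEnd lock x.st) ?_
  · simpa [ReadNet.Fires, fun j : Fin n => not_le.2 j.2] using key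
  intro j
  by_cases hj : j ∈ x.st.agents
  · obtain ⟨y, hy⟩ := x.exists_of_mem hj
    rw [← hy] at hj ⊢
    rw [kappaEnd_copy]
    refine Run.single (step_halfT_end.2 ⟨by simp [hj], ?_, ?_⟩)
    · by_cases hf : j = y.st.first
      · have h1 := y.st.le_prev_first hj
        rw [← hf] at h1
        simp [h1, y.st.prev_mem, ← hf]
      · have h1 := y.st.prev_lt hj hf
        simp [hf, not_le.2 h1]
    · congr 1
      · funext q
        by_cases hq : q ∈ (syncNet Ag).post y.st
        · rcases lt_trichotomy q.1 j with h | h | h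
          · have : q.1.val < j.val + 1 := by omega
            simp [hq, h, h.ne, this]
          · simp [hq, h]
          · have : ¬ q.1.val < j.val + 1 := by omega
            simp [hq, h.ne', this, not_lt.2 h.le]
        · simp [hq]
      · funext k
        rcases lt_trichotomy k j with h | h | h
        · have : ¬ j.val + 1 ≤ k.val := by omega
          simp [h.ne, this, not_le.2 h]
        · simp [h]
        · have : j.val + 1 ≤ k.val := by omega
          simp [h.ne', this, h.le]
  · have h1 : x.st.comp j = none := SyncTrans.comp_eq_none hj
    rw [kappaEnd_of_none lock h1]
    have hlt : ∀ k ∈ x.st.agents, k.val ≠ j.val := fun k hk h => hj (Fin.ext h ▸ hk)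
    convert Run.nil _ using 2
    · funext q
      have : q ∈ (syncNet Ag).post x.st ∧ q.1.val < j.val + 1 ↔
          q ∈ (syncNet Ag).post x.st ∧ q.1.val < j.val :=
        and_congr_right fun h => by have := hlt _ (SyncTrans.mem_agents_of_mem_post h); omega
      simp only [this]
    · funext k
      have : k ∈ x.st.agents ∧ j.val + 1 ≤ k.val ↔ k ∈ x.st.agents ∧ j.val ≤ k.val :=
        and_congr_right fun h => by have := hlt _ h; omega
      simp only [this]

theorem fires_kappa {m m' : Marking (Σ i, P i)} {s : SyncTrans Ag}
    (h : (syncNet Ag).Step m s m') :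
    (simNet Ag lock).Fires (sp Ag m) (kappa Ag lock s) (sp Ag m') := by
  obtain ⟨hm, rfl⟩ := h
  rw [sp_eq_between, sp_eq_between]
  obtain ⟨i, t, ht, hs⟩ | ⟨i, x, rfl⟩ := s.not_shared_or_copy
  · rw [kappa_of_not_shared lock ht hs]
    exact Run.single ((step_uniqT ht).2 ⟨hm, fun _ => rfl, rfl⟩)
  · rw [kappa_eq]
    -- A place in both preset and postset loses its token and regains it. Enabledness makes the
    -- truncated `m q - 1 + 1` equal to `m q`.
    have heff : (syncNet Ag).effect m x.st = fun q => if q ∈ (syncNet Ag).post x.st then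
        (if q ∈ (syncNet Ag).pre x.st then m q - 1 else m q) + 1
        else if q ∈ (syncNet Ag).pre x.st then m q - 1 else m q := by
      funext q
      have := hm q
      by_cases h1 : q ∈ (syncNet Ag).pre x.st <;> by_cases h2 : q ∈ (syncNet Ag).post x.st <;>
        simp_all [PetriNet.effect]
    rw [heff]
    exact (fires_begins lock x hm).append (fires_ends lock x _)

theorem fires_flatMap_kappa {m m' : Marking (Σ i, P i)} {u : List (SyncTrans Ag)}
    (h : (syncNet Ag).Fires m u m') :
    (simNet Ag lock).Fires (sp Ag m) (u.flatMap (kappa Ag lock)) (sp Ag m') := by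
  induction h with
  | nil m => exact .nil _
  | cons hs _ ih => exact (fires_kappa lock hs).append ih

end Agents

section Agents

variable {n : ℕ} {Λ : Type*} {P T : Fin n → Type*} {Ag : ∀ i, PetriNet (P i) (T i) Λ}

/-! ### Occurrences in the simulating sequences -/

section Count

variable (lock : Prop) {i : Fin n}

theorem uniqT_inj {t t' : T i} {h : ¬ Shared Ag i t} {h' : ¬ Shared Ag i t'} :
    uniqT Ag lock i t h = uniqT Ag lock i t' h' ↔ t = t' := by
  simp [uniqT]

theorem halfT_inj {j : Fin n} {x : Copy Ag i} {y : Copy Ag j} {k l : Half} :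
    halfT Ag lock i x k = halfT Ag lock j y l ↔ i = j ∧ x.st = y.st ∧ k = l := by
  constructor
  · intro h
    simp only [halfT, Subtype.mk.injEq, Sigma.mk.injEq] at h
    obtain ⟨rfl, h⟩ := h
    simp only [heq_eq_eq, ModTrans.own.injEq] at h
    exact ⟨rfl, congrArg Copy.st h.1, h.2⟩
  · rintro ⟨rfl, h, rfl⟩
    rw [Copy.eq_of_st h]

theorem count_cons_halfT {j : Fin n} (x : Copy Ag i) (y : Copy Ag j) (k l : Half)
    (v : List (SimTrans Ag lock)) :
    (halfT Ag lock j y l :: v).count (halfT Ag lock i x k) =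
      v.count (halfT Ag lock i x k) + if j = i ∧ y.st = x.st ∧ l = k then 1 else 0 := by
  simp only [List.count_cons, beq_iff_eq, halfT_inj]

theorem uniqT_ne_halfT {j : Fin n} (t : T i) (h : ¬ Shared Ag i t) (x : Copy Ag j) (k : Half) :
    uniqT Ag lock i t h ≠ halfT Ag lock j x k := by
  intro he
  have he' := congrArg Subtype.val he
  simp only [uniqT, halfT, Sigma.mk.injEq] at he'
  obtain ⟨rfl, he'⟩ := he'
  cases he'

theorem uniqT_ne_of_ne {j : Fin n} (hj : j ≠ i) (t : T i) (h : ¬ Shared Ag i t) (t' : T j)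
    (h' : ¬ Shared Ag j t') : uniqT Ag lock j t' h' ≠ uniqT Ag lock i t h :=
  fun he => hj (congrArg (fun τ => τ.1.1) he)

theorem Copy.shared_of_comp (x : Copy Ag i) {j : Fin n} {t : T j} (h : x.st.comp j = some t) :
    Shared Ag j t := by
  obtain ⟨y, hy⟩ := x.exists_of_mem (x.st.mem_agents.2 ⟨t, h⟩)
  obtain rfl : y.tr = t := Option.some.inj (y.mem.symm.trans (hy ▸ h))
  exact y.shared

theorem sum_map_finRange_eq (c : ℕ) :
    ((List.finRange n).map fun j => if j = i then c else 0).sum = c := by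
  rw [← Fin.sum_univ_def]
  simp

theorem count_uniqT_kappa (t : T i) (h : ¬ Shared Ag i t) (s : SyncTrans Ag) :
    (kappa Ag lock s).count (uniqT Ag lock i t h) = if s.comp i = some t then 1 else 0 := by
  obtain ⟨j, t', ht, hs⟩ | ⟨j, x, rfl⟩ := s.not_shared_or_copy
  · rw [kappa_of_not_shared lock ht hs]
    simp only [List.count_singleton, beq_iff_eq]
    by_cases hj : j = i
    · subst hj
      simp only [uniqT_inj, ht, Option.some.injEq]
    · simp [-Subtype.mk.injEq, uniqT_ne_of_ne lock hj, s.comp_eq_none_of_not_shared ht hs (Ne.symm hj)]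
  · rw [if_neg fun h' => h (x.shared_of_comp h'), List.count_eq_zero, kappa_eq, List.mem_append,
      List.mem_flatMap, List.mem_flatMap]
    rintro (⟨k, -, hk⟩ | ⟨k, -, hk⟩) <;> by_cases hm : k ∈ x.st.agents
    · obtain ⟨y, hy⟩ := x.exists_of_mem hm
      rw [← hy, kappaBegin_copy, List.mem_singleton] at hk
      exact uniqT_ne_halfT lock _ _ _ _ hk
    · simp [kappaBegin_of_none lock (SyncTrans.comp_eq_none hm)] at hk
    · obtain ⟨y, hy⟩ := x.exists_of_mem hm
      rw [← hy, kappaEnd_copy, List.mem_singleton] at hk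
      exact uniqT_ne_halfT lock _ _ _ _ hk
    · simp [kappaEnd_of_none lock (SyncTrans.comp_eq_none hm)] at hk

theorem count_halfT_kappaBegin (x : Copy Ag i) (k : Half) (j : Fin n) {i' : Fin n}
    (z : Copy Ag i') :
    (kappaBegin lock z.st j).count (halfT Ag lock i x k) =
      if j = i then (if x.st = z.st ∧ k = .b then 1 else 0) else 0 := by
  by_cases hm : j ∈ z.st.agents
  · obtain ⟨w, hw⟩ := z.exists_of_mem hm
    rw [← hw, kappaBegin_copy, count_cons_halfT, List.count_nil, zero_add]
    by_cases hj : j = i <;> simp [hj, eq_comm]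
  · rw [kappaBegin_of_none lock (SyncTrans.comp_eq_none hm)]
    have : j = i → ¬ x.st = z.st := by
      rintro rfl h
      exact hm (h ▸ x.mem_agents)
    by_cases hj : j = i <;> simp_all

theorem count_halfT_kappaEnd (x : Copy Ag i) (k : Half) (j : Fin n) {i' : Fin n}
    (z : Copy Ag i') :
    (kappaEnd lock z.st j).count (halfT Ag lock i x k) =
      if j = i then (if x.st = z.st ∧ k = .e then 1 else 0) else 0 := by
  by_cases hm : j ∈ z.st.agents
  · obtain ⟨w, hw⟩ := z.exists_of_mem hm
    rw [← hw, kappaEnd_copy, count_cons_halfT, List.count_nil, zero_add]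
    by_cases hj : j = i <;> simp [hj, eq_comm]
  · rw [kappaEnd_of_none lock (SyncTrans.comp_eq_none hm)]
    have : j = i → ¬ x.st = z.st := by
      rintro rfl h
      exact hm (h ▸ x.mem_agents)
    by_cases hj : j = i <;> simp_all

theorem count_halfT_kappa (x : Copy Ag i) (k : Half) (s : SyncTrans Ag) :
    (kappa Ag lock s).count (halfT Ag lock i x k) = if x.st = s then 1 else 0 := by
  obtain ⟨j, t, ht, hs⟩ | ⟨j, z, rfl⟩ := s.not_shared_or_copy
  · have hne : x.st ≠ s := by
      rintro rfl
      exact hs (x.shared_of_comp ht)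
    rw [kappa_of_not_shared lock ht hs, if_neg hne, List.count_cons_of_ne (uniqT_ne_halfT lock _ _ _ _),
      List.count_nil]
  · rw [kappa_eq, List.count_append, List.count_flatMap, List.count_flatMap]
    have h1 : List.count (halfT Ag lock i x k) ∘ kappaBegin lock z.st =
        fun j => if j = i then (if x.st = z.st ∧ k = .b then 1 else 0) else 0 :=
      funext fun j => count_halfT_kappaBegin lock x k j z
    have h2 : List.count (halfT Ag lock i x k) ∘ kappaEnd lock z.st =
        fun j => if j = i then (if x.st = z.st ∧ k = .e then 1 else 0) else 0 :=
      funext fun j => count_halfT_kappaEnd lock x k j z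
    rw [h1, h2, sum_map_finRange_eq, sum_map_finRange_eq]
    cases k <;> simp

/-- No other agent uses the label, so `t` alone is a complete combination. -/
theorem exists_syncTrans_of_not_shared (t : T i) (h : ¬ Shared Ag i t) :
    ∃ s : SyncTrans Ag, s.comp i = some t := by
  refine ⟨⟨(Ag i).label t, Function.update (fun _ => none) i (some t), ⟨i, by simp⟩, ?_, ?_⟩,
    by simp⟩
  · intro j t' hj
    by_cases hji : j = i
    · subst hji
      simp at hj
      rw [hj]
    · simp [hji] at hj
  · intro j hj t' ht'
    by_cases hji : j = i
    · subst hji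
      simp at hj
    · exact h ⟨j, hji, t', ht'⟩

end Count

/-! ### The simulation relation -/

/-- The agent `i` has begun `s`, and the first participant of `s` has not yet ended. -/
def Begun (act : Fin n → Option (SyncTrans Ag)) (i : Fin n) (s : SyncTrans Ag) : Prop :=
  act i = some s ∧ act s.first = some s

/-- The agent `i` has not yet ended `s`, but the first participant of `s` has. -/
def Committed (act : Fin n → Option (SyncTrans Ag)) (i : Fin n) (s : SyncTrans Ag) : Prop :=
  act i = some s ∧ act s.first ≠ some s

/-- The intermediate marking `between m act` of the simulating net represents the marking `M` of
the global net: every combination takes place at the moment when its first participant ends. -/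
structure Represents (m : Marking (Σ i, P i)) (act : Fin n → Option (SyncTrans Ag))
    (M : Marking (Σ i, P i)) : Prop where
  copy : ∀ {i s}, act i = some s → ∃ x : Copy Ag i, x.st = s
  -- While the first participant is active, the active participants form a prefix (`down`);
  -- otherwise they form a suffix, possibly empty (`up`).
  down : ∀ {s : SyncTrans Ag} {i j}, act s.first = some s → i ∈ s.agents → i ≤ j →
    act j = some s → act i = some s
  up : ∀ {s : SyncTrans Ag} {i j}, act s.first ≠ some s → j ∈ s.agents → i ≤ j →
    act i = some s → act j = some s
  -- Tokens consumed too early are given back, and tokens produced too late are credited.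
  marking : ∀ q, M q = m q + (if ∃ s, Begun act q.1 s ∧ q ∈ (syncNet Ag).pre s then 1 else 0) +
    if ∃ s, Committed act q.1 s ∧ q ∈ (syncNet Ag).post s then 1 else 0

namespace Represents

variable {m M : Marking (Σ i, P i)} {act : Fin n → Option (SyncTrans Ag)}

theorem idle (M : Marking (Σ i, P i)) : Represents (Ag := Ag) M (fun _ => none) M where
  copy h := by simp at h
  down h := by simp at h
  up _ _ _ h := by simp at h
  marking q := by simp [Begun, Committed]

variable {i : Fin n}

theorem mem_agents (h : Represents m act M) {s : SyncTrans Ag} (hi : act i = some s) :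
    i ∈ s.agents := by
  obtain ⟨x, rfl⟩ := h.copy hi
  exact x.mem_agents

/-- Since `M` dominates `m`, enabledness carries over, even when the agent is in the middle of a
combination; the two corrections are unaffected. -/
theorem step_single (h : Represents m act M) {s : SyncTrans Ag}
    (hs : (syncNet Ag).Enabled m s) :
    (syncNet Ag).Step M s ((syncNet Ag).effect M s) ∧
      Represents ((syncNet Ag).effect m s) act ((syncNet Ag).effect M s) := by
  refine ⟨⟨fun q hq => ?_, rfl⟩, h.copy, h.down, h.up, fun q => ?_⟩
  · have := hs q hq
    have := h.marking q
    omega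
  · have h1 := hs q
    simp only [PetriNet.effect, h.marking q, Set.mem_sdiff]
    by_cases hp : q ∈ (syncNet Ag).pre s
    · have := h1 hp
      by_cases hq : q ∈ (syncNet Ag).post s <;> simp only [hp, hq] <;> simp
      omega
    · by_cases hq : q ∈ (syncNet Ag).post s <;> simp only [hp, hq] <;> simp
      omega

/-- The tokens removed from `m` are exactly those that the new begun entry gives back, so `M` stays
fixed. -/
theorem begin_step (h : Represents m act M) (x : Copy Ag i)
    (hm : ∀ q ∈ (syncNet Ag).pre x.st, q.1 = i → 1 ≤ m q) (hi : act i = none)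
    (ht : act (x.st.prev i) = some x.st ↔ i ≠ x.st.first) :
    Represents (fun q => if q ∈ (syncNet Ag).pre x.st ∧ q.1 = i then m q - 1 else m q)
        (Function.update act i (some x.st)) M ∧
      (∀ j r, Begun (Function.update act i (some x.st)) j r ↔
        Begun act j r ∨ j = i ∧ r = x.st) ∧
      (∀ j r, Committed (Function.update act i (some x.st)) j r ↔ Committed act j r) := by
  generalize hact' : Function.update act i (some x.st) = act'
  have H : ∀ j r, act' j = some r ↔ act j = some r ∨ j = i ∧ r = x.st := by
    intro j r
    subst hact'
    by_cases hj : j = i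
    · subst hj
      simp [hi, eq_comm]
    · simp [hj]
  -- Had the first participant already ended, the suffix containing the predecessor would contain
  -- the idle agent `i`.
  have h_first : i ≠ x.st.first → act x.st.first = some x.st := by
    intro hf
    by_contra hc
    have := h.up hc x.mem_agents (x.st.prev_lt x.mem_agents hf).le (ht.2 hf)
    simp [hi] at this
  -- A participant left over from an earlier round would, by `up`, keep the last one active, against
  -- the test.
  have h_idle : i = x.st.first → ∀ j, act j ≠ some x.st := by
    intro hf j hj
    have h1 := x.st.le_prev_first (h.mem_agents hj)
    rw [← hf] at h1
    refine ht.1 (h.up ?_ (x.st.prev_mem i) h1 hj) hf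
    rw [← hf, hi]
    simp
  have h_act : ∀ j, act j = some x.st → act x.st.first = some x.st := fun j hj =>
    h_first fun hf => h_idle hf j hj
  have h_first' : act' x.st.first = some x.st := by
    rw [H]
    by_cases hf : i = x.st.first
    · exact Or.inr ⟨hf.symm, rfl⟩
    · exact Or.inl (h_first hf)
  have h_prefix : ∀ j ∈ x.st.agents, j < i → act j = some x.st := by
    intro j hj hlt
    have hf : i ≠ x.st.first := fun hf => not_lt.2 (x.st.first_le hj) (hf ▸ hlt)
    exact h.down (h_first hf) hj (x.st.le_prev hj hlt) (ht.2 hf)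
  have hB : ∀ j r, Begun act' j r ↔ Begun act j r ∨ j = i ∧ r = x.st := by
    intro j r
    by_cases hr : r = x.st
    · subst hr
      have := h_act j
      simp only [Begun, h_first', H j]
      tauto
    · simp [Begun, H, hr]
  have hC : ∀ j r, Committed act' j r ↔ Committed act j r := by
    intro j r
    by_cases hr : r = x.st
    · subst hr
      have := h_act j
      simp only [Committed, h_first']
      tauto
    · simp [Committed, H, hr]
  refine ⟨⟨?_, ?_, ?_, ?_⟩, hB, hC⟩
  · intro j s hj
    obtain hj | ⟨rfl, rfl⟩ := (H j s).1 hj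
    · exact h.copy hj
    · exact ⟨x, rfl⟩
  · intro s j k hf hj hjk hk
    by_cases hs : s = x.st
    · subst hs
      rw [H] at hk ⊢
      obtain hk | ⟨rfl, -⟩ := hk
      · exact Or.inl (h.down (h_act k hk) hj hjk hk)
      · obtain rfl | hlt := eq_or_lt_of_le hjk
        · exact Or.inr ⟨rfl, rfl⟩
        · exact Or.inl (h_prefix j hj hlt)
    · simp only [H, hs, and_false, or_false] at hf hk ⊢
      exact h.down hf hj hjk hk
  · intro s j k hf hk hjk hj
    by_cases hs : s = x.st
    · subst hs
      exact absurd h_first' hf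
    · rw [Ne] at hf
      simp only [H, hs, and_false, or_false] at hf hj ⊢
      exact h.up hf hk hjk hj
  · intro q
    rw [h.marking q]
    simp only [hB, hC]
    by_cases hq : q.1 = i
    · have h1 := hm q
      have hn : ∀ s, ¬ Begun act i s := fun s hs => by simp [Begun, hi] at hs
      by_cases hp : q ∈ (syncNet Ag).pre x.st
      · have := h1 hp hq
        simp [hq, hp, hn]
        omega
      · simp [hq, hp, hn]
    · simp [hq]

/-- The combination was committed earlier, so `M` already contains the tokens now produced. -/
theorem end_step (h : Represents m act M) (x : Copy Ag i) (hi : act i = some x.st)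
    (ht : act (x.st.prev i) ≠ some x.st) (hf : i ≠ x.st.first) :
    Represents (fun q => if q ∈ (syncNet Ag).post x.st ∧ q.1 = i then m q + 1 else m q)
        (Function.update act i none) M ∧
      (∀ j r, Begun (Function.update act i none) j r ↔ Begun act j r) ∧
      (∀ j r, Committed act j r ↔
        Committed (Function.update act i none) j r ∨ j = i ∧ r = x.st) := by
  generalize hact' : Function.update act i none = act'
  have hi' : act' i = none := by simp [← hact']
  have H : ∀ j r, act j = some r ↔ act' j = some r ∨ j = i ∧ r = x.st := by
    intro j r
    subst hact'
    by_cases hj : j = i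
    · subst hj
      simp [hi, eq_comm]
    · simp [hj]
  -- If the first participant were still active, the prefix property would make the predecessor
  -- active, against the test.
  have h_first : act x.st.first ≠ some x.st := fun hc =>
    ht (h.down hc (x.st.prev_mem i) (x.st.prev_lt x.mem_agents hf).le hi)
  have h_first' : ∀ r : SyncTrans Ag, act r.first = some r ↔ act' r.first = some r := by
    intro r
    by_cases hr : r = x.st
    · subst hr
      simp [H, Ne.symm hf]
    · simp [H, hr]
  have hB : ∀ j r, Begun act' j r ↔ Begun act j r := by
    intro j r
    by_cases hr : r = x.st
    · subst hr
      simp [Begun, ← h_first', h_first]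
    · simp [Begun, H, hr]
  have hC : ∀ j r, Committed act j r ↔ Committed act' j r ∨ j = i ∧ r = x.st := by
    intro j r
    by_cases hr : r = x.st
    · subst hr
      simp only [Committed, Ne, ← h_first', h_first, H j]
      tauto
    · simp [Committed, H, hr]
  refine ⟨⟨?_, ?_, ?_, ?_⟩, hB, hC⟩
  · intro j s hj
    exact h.copy ((H j s).2 (Or.inl hj))
  · intro s j k hsf hj hjk hk
    rw [← h_first'] at hsf
    have hs : s ≠ x.st := by
      rintro rfl
      exact h_first hsf
    have := h.down hsf hj hjk ((H k s).2 (Or.inl hk))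
    simpa [H, hs] using this
  · intro s j k hsf hk hjk hj
    rw [Ne, ← h_first'] at hsf
    have hj1 := (H j s).2 (Or.inl hj)
    have hk1 := h.up hsf hk hjk hj1
    obtain hk2 | ⟨rfl, rfl⟩ := (H k s).1 hk1
    · exact hk2
    · obtain rfl | hlt := eq_or_lt_of_le hjk
      · exact hj
      -- An active participant below the ending agent would, by `up`, make its predecessor active.
      · exact absurd (h.up hsf (x.st.prev_mem k) (x.st.le_prev (h.mem_agents hj1) hlt) hj1) ht
  · intro q
    rw [h.marking q]
    simp only [hB, hC]
    by_cases hq : q.1 = i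
    · have hn : ∀ s, ¬ Committed act' i s := fun s hs => by simp [Committed, hi'] at hs
      by_cases hp : q ∈ (syncNet Ag).post x.st
      · simp [hq, hp, hn]
        omega
      · simp [hq, hp, hn]
    · simp [hq]

/-- All participants are active here, so every preset has been consumed and is contained in `M`: the
combination can occur globally. The remaining participants pass from begun to committed, trading
their consumed presets for owed postsets. -/
theorem commit_step (h : Represents m act M) (x : Copy Ag i) (hi : act i = some x.st)
    (ht : act (x.st.prev i) = some x.st) (hf : i = x.st.first) :
    (syncNet Ag).Step M x.st ((syncNet Ag).effect M x.st) ∧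
      Represents (fun q => if q ∈ (syncNet Ag).post x.st ∧ q.1 = i then m q + 1 else m q)
        (Function.update act i none) ((syncNet Ag).effect M x.st) ∧
      (∀ j r, Begun act j r ↔
        Begun (Function.update act i none) j r ∨ j ∈ x.st.agents ∧ r = x.st) ∧
      (∀ j r, Committed (Function.update act i none) j r ↔
        Committed act j r ∨ j ∈ x.st.agents ∧ j ≠ i ∧ r = x.st) := by
  generalize hact' : Function.update act i none = act'
  have hi' : act' i = none := by simp [← hact']
  have H : ∀ j r, act j = some r ↔ act' j = some r ∨ j = i ∧ r = x.st := by
    intro j r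
    subst hact'
    by_cases hj : j = i
    · subst hj
      simp [hi, eq_comm]
    · simp [hj]
  have h_first : act x.st.first = some x.st := hf ▸ hi
  have h_first' : act' x.st.first ≠ some x.st := by
    rw [← hf, hi']
    simp
  -- The last participant is active by the test, and the prefix up to it contains everybody.
  have h_all : ∀ j, act j = some x.st ↔ j ∈ x.st.agents := by
    refine fun j => ⟨h.mem_agents, fun hj => ?_⟩
    have h1 := x.st.le_prev_first hj
    rw [← hf] at h1
    exact h.down h_first hj h1 ht
  have h_all' : ∀ j, act' j = some x.st ↔ j ∈ x.st.agents ∧ j ≠ i := by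
    intro j
    rw [← h_all, H]
    by_cases hj : j = i
    · subst hj
      simp [hi']
    · simp [hj]
  have hB : ∀ j r, Begun act j r ↔ Begun act' j r ∨ j ∈ x.st.agents ∧ r = x.st := by
    intro j r
    by_cases hr : r = x.st
    · subst hr
      simp [Begun, h_first, h_first', h_all]
    · simp [Begun, H, hr]
  have hC : ∀ j r, Committed act' j r ↔
      Committed act j r ∨ j ∈ x.st.agents ∧ j ≠ i ∧ r = x.st := by
    intro j r
    by_cases hr : r = x.st
    · subst hr
      simp [Committed, h_first, h_first', h_all']
    · simp [Committed, H, hr]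
  have hM : ∀ q : Σ i, P i, q.1 ∈ x.st.agents →
      M q = m q + if q ∈ (syncNet Ag).pre x.st then 1 else 0 := by
    intro q hq
    have hq' := (h_all _).2 hq
    rw [h.marking q]
    simp [Begun, Committed, hq', h_first]
  refine ⟨⟨fun q hq => ?_, rfl⟩, ⟨?_, ?_, ?_, ?_⟩, hB, hC⟩
  · rw [hM q (SyncTrans.mem_agents_of_mem_pre hq), if_pos hq]
    omega
  · intro j s hj
    exact h.copy ((H j s).2 (Or.inl hj))
  · intro s j k hsf hj hjk hk
    have hs : s ≠ x.st := by
      rintro rfl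
      exact h_first' hsf
    have := h.down ((H _ s).2 (Or.inl hsf)) hj hjk ((H k s).2 (Or.inl hk))
    simpa [H, hs] using this
  · intro s j k hsf hk hjk hj
    by_cases hs : s = x.st
    · subst hs
      rw [h_all'] at hj ⊢
      refine ⟨hk, ?_⟩
      rintro rfl
      exact hj.2 (le_antisymm hjk (hf ▸ x.st.first_le hj.1))
    · have := h.up (by simpa [H, hs] using hsf) hk hjk ((H j s).2 (Or.inl hj))
      simpa [H, hs] using this
  · intro q
    by_cases hq : q.1 ∈ x.st.agents
    · have hq' := (h_all _).2 hq
      have hn : ∀ s, ¬ Begun act' q.1 s := by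
        rintro s ⟨h1, h2⟩
        obtain rfl : x.st = s := Option.some.inj (hq'.symm.trans ((H _ _).2 (Or.inl h1)))
        exact h_first' h2
      have hn' : ∀ s, ¬ Committed act q.1 s := by
        rintro s ⟨h1, h2⟩
        obtain rfl : x.st = s := Option.some.inj (hq'.symm.trans h1)
        exact h2 h_first
      simp only [PetriNet.effect, hM q hq, hC, hn, hn', hq]
      by_cases hp : q ∈ (syncNet Ag).pre x.st <;> by_cases hp' : q ∈ (syncNet Ag).post x.st <;>
        by_cases hqi : q.1 = i <;> simp [hp, hp', hqi]
    · have h1 : q ∉ (syncNet Ag).pre x.st := fun h => hq (SyncTrans.mem_agents_of_mem_pre h)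
      have h2 : q ∉ (syncNet Ag).post x.st := fun h => hq (SyncTrans.mem_agents_of_mem_post h)
      simp only [PetriNet.effect, h.marking q, hB, hC]
      simp [h1, h2, hq]

end Represents

/-! ### From the simulating net to the global net -/

theorem between_eq_sp {m M : Marking (Σ i, P i)} {act : Fin n → Option (SyncTrans Ag)}
    (h : between m act = sp Ag M) : m = M ∧ act = fun _ => none := by
  refine ⟨funext fun ⟨i, p⟩ => congrFun h ⟨i, .orig p⟩, funext fun i => ?_⟩
  have h1 := congrFun h ⟨i, .sync⟩
  by_contra h2
  simp [between, sp, h2] at h1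

/-- Both corrections are needed for an induction from an arbitrary intermediate marking: a
combination in progress but uncommitted belongs to `u` although some of its begins precede `v`; a
committed one does not belong to `u` although some of its ends lie in `v`. -/
theorem exists_fires_of_fires (lock : Prop) {M₂ : Marking (Σ i, P i)}
    (v : List (SimTrans Ag lock)) :
    ∀ {m M : Marking (Σ i, P i)} {act : Fin n → Option (SyncTrans Ag)}, Represents m act M →
      (simNet Ag lock).Fires (between m act) v (sp Ag M₂) →
      ∃ u : List (SyncTrans Ag), (syncNet Ag).Fires M u M₂ ∧
        v.filterMap (visible Ag lock) = u.map (syncNet Ag).label ∧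
        (∀ i t h, v.count (uniqT Ag lock i t h) =
          (u.flatMap (kappa Ag lock)).count (uniqT Ag lock i t h)) ∧
        (∀ i x, v.count (halfT Ag lock i x .b) + (if Begun act i x.st then 1 else 0) =
          (u.flatMap (kappa Ag lock)).count (halfT Ag lock i x .b)) ∧
        (∀ i x, v.count (halfT Ag lock i x .e) =
          (u.flatMap (kappa Ag lock)).count (halfT Ag lock i x .e) +
            if Committed act i x.st then 1 else 0) := by
  induction v with
  | nil =>
    intro m M act h hv
    generalize hσ : sp Ag M₂ = σ at hv
    cases hv
    -- In `sp M₂` all synchronization places are marked, so no combination is left in progress.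
    obtain ⟨rfl, rfl⟩ := between_eq_sp hσ.symm
    obtain rfl : M = m := funext fun q => by simpa [Begun, Committed] using h.marking q
    exact ⟨[], .nil _, rfl, fun _ _ _ => rfl, fun _ _ => by simp [Begun],
      fun _ _ => by simp [Committed]⟩
  | cons τ v ih =>
    intro m M act h hv
    cases hv with
    | cons hstep hv =>
    obtain ⟨i, t, ht, rfl⟩ | ⟨i, x, k, rfl⟩ := eq_uniqT_or_eq_halfT τ
    · obtain ⟨s, hs⟩ := exists_syncTrans_of_not_shared t ht
      obtain ⟨h1, -, rfl⟩ := (step_uniqT hs).1 hstep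
      obtain ⟨h2, h3⟩ := h.step_single h1
      obtain ⟨u, hu, hvis, hcu, hcb, hce⟩ := ih h3 hv
      have hk := kappa_of_not_shared lock hs ht
      refine ⟨s :: u, .cons h2 hu, ?_, fun j t' h' => ?_, fun j y => ?_, fun j y => ?_⟩
      · simp [hvis, syncNet, s.label_eq i t hs]
      · rw [List.flatMap_cons, hk, List.singleton_append, List.count_cons, List.count_cons, hcu]
      · rw [List.flatMap_cons, hk, List.singleton_append, List.count_cons, List.count_cons, ← hcb]
        omega
      · rw [List.flatMap_cons, hk, List.singleton_append, List.count_cons, List.count_cons, hce]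
        omega
    · cases k with
      | b =>
        obtain ⟨h1, h2, h3, rfl⟩ := step_halfT_begin.1 hstep
        obtain ⟨h4, hB, hC⟩ := h.begin_step x h1 h2 h3
        obtain ⟨u, hu, hvis, hcu, hcb, hce⟩ := ih h4 hv
        refine ⟨u, hu, (List.filterMap_cons_none rfl).trans hvis, fun j t' h' => ?_, fun j y => ?_, fun j y => ?_⟩
        · rw [List.count_cons_of_ne (uniqT_ne_halfT lock _ _ _ _).symm, hcu]
        · rw [← hcb, count_cons_halfT]
          simp only [hB]
          by_cases hj : i = j
          · subst hj
            have hn : ¬ Begun act i y.st := fun hn => by simp [Begun, h2] at hn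
            simp [hn, eq_comm]
          · simp [hj, Ne.symm hj]
        · rw [count_cons_halfT, hce]
          simp [hC]
      | e =>
        obtain ⟨h1, h2, rfl⟩ := step_halfT_end.1 hstep
        by_cases hf : i = x.st.first
        · obtain ⟨h3, h4, hB, hC⟩ := h.commit_step x h1 (h2.2 hf) hf
          obtain ⟨u, hu, hvis, hcu, hcb, hce⟩ := ih h4 hv
          refine ⟨x.st :: u, .cons h3 hu, ?_, fun j t' h' => ?_, fun j y => ?_, fun j y => ?_⟩
          · simp [hvis, ← hf, syncNet]
          · rw [List.flatMap_cons, List.count_append, count_uniqT_kappa,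
              if_neg fun hc => h' (x.shared_of_comp hc),
              List.count_cons_of_ne (uniqT_ne_halfT lock _ _ _ _).symm, hcu, zero_add]
          · rw [List.flatMap_cons, List.count_append, count_halfT_kappa,
              count_cons_halfT, ← hcb]
            simp only [hB]
            by_cases hy : y.st = x.st
            · have hn : ¬ Begun (Function.update act i none) j x.st := by
                simp [Begun, ← hf]
              simp [hy, hn, hy ▸ y.mem_agents]
              omega
            · simp [hy]
          · rw [List.flatMap_cons, List.count_append, count_halfT_kappa, count_cons_halfT, hce]
            simp only [hC]
            by_cases hy : y.st = x.st
            · have hn : ¬ Committed act j x.st := by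
                simp [Committed, ← hf, h1]
              by_cases hj : i = j
              · simp [hj, hy, hn, add_comm]
              · simp [hj, Ne.symm hj, hy, hn, hy ▸ y.mem_agents, add_comm]
            · simp [hy, Ne.symm hy]
        · obtain ⟨h4, hB, hC⟩ := h.end_step x h1 (fun hc => hf (h2.1 hc)) hf
          obtain ⟨u, hu, hvis, hcu, hcb, hce⟩ := ih h4 hv
          refine ⟨u, hu, by simp [hvis, hf], fun j t' h' => ?_, fun j y => ?_, fun j y => ?_⟩
          · rw [List.count_cons_of_ne (uniqT_ne_halfT lock _ _ _ _).symm, hcu]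
          · rw [count_cons_halfT, ← hcb]
            simp [hB]
          · rw [count_cons_halfT, hce]
            simp only [hC]
            by_cases hj : i = j
            · subst hj
              have hn : ¬ Committed (Function.update act i none) i y.st := by simp [Committed]
              simp [hn, eq_comm]
            · simp [hj, Ne.symm hj]

end Agents

end PetriMAS

end

theorem theorem1 {n : ℕ} {Λ : Type*} {P T : Fin n → Type*}
    (Ag : ∀ i, PetriNet (P i) (T i) Λ) (hsafe : ∀ i, (Ag i).IsSafe) (lock : Prop)
    (M₁ M₂ : Marking (Σ i, P i))
    (h₁ : (syncNet Ag).Reachable M₁) (h₂ : (syncNet Ag).Reachable M₂) :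
    (∀ v : List (SimTrans Ag lock),
      (simNet Ag lock).Fires (sp Ag M₁) v (sp Ag M₂) →
        ∃ u : List (SyncTrans Ag), (syncNet Ag).Fires M₁ u M₂ ∧
          parikh v = parikh (u.flatMap (kappa Ag lock)) ∧
          v.filterMap (visible Ag lock) = u.map (syncNet Ag).label) ∧
    (∀ u : List (SyncTrans Ag), (syncNet Ag).Fires M₁ u M₂ →
        ∃ v : List (SimTrans Ag lock),
          (simNet Ag lock).Fires (sp Ag M₁) v (sp Ag M₂) ∧
          parikh v = parikh (u.flatMap (kappa Ag lock)) ∧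
          v.filterMap (visible Ag lock) = u.map (syncNet Ag).label) := by
  refine ⟨fun v hv => ?_, fun u hu => ⟨_, fires_flatMap_kappa lock hu, rfl,
    filterMap_visible_flatMap_kappa lock u⟩⟩
  obtain ⟨u, hu, hvis, hcu, hcb, hce⟩ := exists_fires_of_fires lock v (Represents.idle M₁)
    (sp_eq_between (Ag := Ag) M₁ ▸ hv)
  refine ⟨u, hu, Multiset.coe_eq_coe.2 ?_, hvis⟩
  classical
  refine List.perm_iff_count.2 fun τ => ?_
  obtain ⟨i, t, ht, rfl⟩ | ⟨i, x, k, rfl⟩ := eq_uniqT_or_eq_halfT τ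
  · convert hcu i t ht
  -- The run starts from an idle marking, where both corrections vanish.
  · cases k
    · convert hcb i x using 1
      simp [Begun]
    · convert hce i x using 1
      simp [Committed]
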